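/- Let $K\ge 1$, $\theta^*\in\mathbb R^K$ and $\sigma>0$, and work on one probability space $(\Omega,\mathbb P)$. For each horizon $n$ let $\{\mathcal F_t\}_{t\ge 0}$ be an increasing sequence of $\sigma$-fields, and for $1\le t\le n$ let the $\mathcal F_{t-1}$-measurable arm vector $x_t\in\{e_1,\dots,e_K\}$ and the $\mathcal F_t$-measurable reward $y_t=x_t^\top\theta^*+\epsilon_t$ be the data of a $K$-armed bandit; all of these may depend on $n$ (the case where they do not is included). Suppose that for all $n$ and $1\le t\le n$, almost surely, $$\mathbb E[\epsilon_t\mid\mathcal F_{t-1}]=0,\qquad \mathbb E[\epsilon_t^2\mid\mathcal F_{t-1}]=\sigma^2,$$ and that for some $\delta>0$ the supremum of $\mathbb E[|\epsilon_t/\sigma|^{2+\delta}\mid\mathcal F_{t-1}]$ over all $n$ and all $1\le t\le n$ is almost surely finite (if the data do not depend on $n$, this is the supremum over $t\ge1$). Let $f:[1,\infty)\to(0,\infty)$ be a deterministic decreasing (not necessarily strictly) function with $\int_1^\infty f^2(u)\,du=1$ and $\int_1^\infty f(u)\,du=\infty$. For each $n$ and each arm $j$ let $s_0$ be a positive $\mathcal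 F_0$-measurable random variable (which may depend on $n$ and $j$), and put $$s_{t,j}=s_0+\sum_{i=1}^t x_{i,j}^2,\qquad w_{t,j}=f\Big(\frac{s_{t,j}}{s_0}\Big)\frac{x_{t,j}}{\sqrt{s_0}} .$$ Let the ALEE (adaptive linear estimating equations) estimate $\widehat\theta$ be any random vector in $\mathbb R^K$ that solves $\sum_{t=1}^n w_t\,(y_t-x_t^\top\widehat\theta)=0$, where $w_t=(w_{t,1},\dots,w_{t,K})$, and let $\widehat\sigma=\widehat\sigma_n$ be real random variables converging to $\sigma$ in probability. Suppose that for some arm $k$, with the corresponding $s_0$, both $1/s_0\to0$ and $s_0/s_{n,k}\to 0$ in probability as $n\to\infty$. Then, as $n\to\infty$, $$(\widehat\theta_k-\theta^*_k)\int_1^{s_{n,k}/s_0}\frac{\sqrt{s_0}}{\widehat\sigma}f(u)\,du\ \xrightarrow{d}\ \mathcal N(0,1)$$ and $$\frac{1}{\widehat\sigma\,\big(\sum_{t=1}^n w_{t,k}^2\big)^{1/2}}\Big(\sum_{t=1}^n w_{t,k}x_{t,k}\Big)(\widehat\theta_k-\theta^*_k)\ \xrightarrow{d}\ \mathcal N(0,1).$$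 (The quotients by $\widehat\sigma$ and by $\sum_t w_{t,k}^2$ may be given any fixed value, say $0$, where they are undefined.) -/

import Mathlib

open MeasureTheory ProbabilityTheory Filter
open scoped Topology ENNReal

namespace Bandit

/-- A `K`-armed bandit experiment of horizon `n`, viewed as an adaptive linear model: at time
`t = 1, …, n` the covariate vector `x t` is one of the standard basis vectors (the arm pulled), it
is measurable with respect to the past `F (t - 1)`, and the observed reward is
`y t = ⟨x t, θ⟩ + ε t`. -/
structure IsBandit {Ω : Type*} {mΩ : MeasurableSpace Ω} {K : ℕ} (F : Filtration ℕ mΩ)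
    (θ : Fin K → ℝ) (x : ℕ → Ω → Fin K → ℝ) (y ε : ℕ → Ω → ℝ) (n : ℕ) : Prop where
  arm : ∀ t ∈ Finset.Icc 1 n, ∀ ω, ∃ j : Fin K, x t ω = Pi.single j 1
  reward : ∀ t ∈ Finset.Icc 1 n, ∀ ω, y t ω = x t ω ⬝ᵥ θ + ε t ω
  arm_measurable : ∀ t ∈ Finset.Icc 1 n, Measurable[F (t - 1)] (x t)
  reward_measurable : ∀ t ∈ Finset.Icc 1 n, Measurable[F t] (y t)

/-- The noise condition, for a sequence of experiments indexed by the horizon `n`.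
If the noise and the filtration do not depend on `n`, the supremum in `moment` is the supremum over
all `t ≥ 1`. The conditional moment of order `2 + δ` is that of a `[0, ∞]`-valued function, so no
integrability is presupposed there. Since `σ ≠ 0` where this is used, `variance` forces `ε n t` to
be square integrable, so the Bochner conditional expectations are genuine ones. -/
structure NoiseCondition {Ω : Type*} {mΩ : MeasurableSpace Ω} (P : Measure Ω)
    (F : ℕ → Filtration ℕ mΩ) (ε : ℕ → ℕ → Ω → ℝ) (σ : ℝ) : Prop where
  mean : ∀ n, ∀ t ∈ Finset.Icc 1 n, P[ε n t | F n (t - 1)] =ᵐ[P] fun _ => 0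
  variance : ∀ n, ∀ t ∈ Finset.Icc 1 n,
    P[fun ω => ε n t ω ^ 2 | F n (t - 1)] =ᵐ[P] fun _ => σ ^ 2
  moment : ∃ δ : ℝ, 0 < δ ∧ ∀ᵐ ω ∂P, (⨆ n : ℕ, ⨆ t ∈ Finset.Icc 1 n,
    P⁻[fun ω' => ENNReal.ofReal (|ε n t ω' / σ| ^ (2 + δ)) | F n (t - 1)] ω) < ∞

/-- `f` is positive and decreasing on `[1, ∞)`, `∫₁^∞ f² = 1` and `∫₁^∞ f = ∞`. -/
structure IsWeightFunction (f : ℝ → ℝ) : Prop where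
  pos : ∀ u, 1 ≤ u → 0 < f u
  antitone : AntitoneOn f (Set.Ici 1)
  integral_sq : ∫⁻ u in Set.Ioi (1 : ℝ), ENNReal.ofReal (f u ^ 2) = 1
  integral_eq_top : ∫⁻ u in Set.Ioi (1 : ℝ), ENNReal.ofReal (f u) = ∞

/-- `s_t = s₀ + ∑_{i=1}^t z_i²`, for one coordinate `z` of the covariates. -/
def partialSum (s₀ : ℝ) (z : ℕ → ℝ) (t : ℕ) : ℝ :=
  s₀ + ∑ i ∈ Finset.Icc 1 t, z i ^ 2

/-- `w_t = f (s_t / s₀) z_t / √s₀`, for one coordinate `z` of the covariates. -/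
noncomputable def weight (f : ℝ → ℝ) (s₀ : ℝ) (z : ℕ → ℝ) (t : ℕ) : ℝ :=
  f (partialSum s₀ z t / s₀) * (z t / √s₀)

/-- `θhat` solves the adaptive linear estimating equations
`∑_{t=1}^n w_t (y_t - ⟨x_t, θhat⟩) = 0`. -/
def IsALEE {K : ℕ} (w x : ℕ → Fin K → ℝ) (y : ℕ → ℝ) (n : ℕ) (θhat : Fin K → ℝ) : Prop :=
  ∑ t ∈ Finset.Icc 1 n, (y t - x t ⬝ᵥ θhat) • w t = 0

end Bandit

namespace Bandit

/-! A bandit covariate has a single nonzero coordinate, so the `k`-th estimating equation decouples: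
`(∑ w_t x_t)(θhat_k - θ_k) = ∑ w_t ε_t`, a martingale transform with predictable weights
(`IsBandit.sum_weight_mul_sub_eq`).

Each pull of arm `k` advances `s_t / s₀` by `1 / s₀`, so `V = ∑ w_t²` is a right-endpoint Riemann
sum of `f²` over `[1, s_n / s₀]`. As `f` decreases, `V` is at most `∫ f² ≤ 1` for every outcome and
falls short of the integral by at most `f(1)² / s₀` (`riemannSum_le_integral_le`). Hence `V → 1` in
probability, however random the number of pulls. Single weights are at most `f(1) / √s₀ → 0`, so the
martingale CLT `tendstoInDistribution_sum_mul` applies to `M = ∑ w_t ε_t / σ`.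

That CLT is proved with characteristic functions. Because `V ≤ 1`, the variable `exp(iuS + u²V/2)`
is bounded; telescoping over time shows that its expectation tends to `1`, and then `V` is replaced
by its limit.

For the normalizations, `∑ w_t x_t = √s₀ H` with `H` a Riemann sum of `f`. Divergence of `∫ f` keeps
`I = ∫₁^{s_n/s₀} f` away from `0`, while `I - H ≤ f(1) / s₀`, so `I / H → 1`. Slutsky's lemma
finishes both claims. -/

/-! ### Taylor estimates for the exponential -/

lemma norm_cexp_taylor_two_le_sq_and_cube (x : ℝ) :
    ‖Complex.exp (x * Complex.I) - 1 - x * Complex.I + x ^ 2 / 2‖ ≤ 4 * x ^ 2 ∧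
      ‖Complex.exp (x * Complex.I) - 1 - x * Complex.I + x ^ 2 / 2‖ ≤ 4 * |x| ^ 3 := by
  rcases le_total |x| 1 with hx | hx
  · have h := Complex.norm_exp_sub_sum_le_norm_mul_exp (x * Complex.I) 3
    have he : Complex.exp (x * Complex.I) - ∑ m ∈ Finset.range 3, (x * Complex.I) ^ m / m.factorial
        = Complex.exp (x * Complex.I) - 1 - x * Complex.I + x ^ 2 / 2 := by
      simp [Finset.sum_range_succ, mul_pow]
      ring
    rw [he] at h
    have hn : ‖(x : ℂ) * Complex.I‖ = |x| := by simp
    rw [hn] at h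
    have h3 : Real.exp |x| ≤ 4 := by
      have := Real.exp_le_exp.2 hx
      have := Real.exp_one_lt_d9
      linarith
    have h4 : |x| ^ 3 * Real.exp |x| ≤ 4 * |x| ^ 3 := by
      rw [mul_comm]
      gcongr
    have h5 : |x| ^ 3 ≤ x ^ 2 := by
      rw [← sq_abs x]
      exact pow_le_pow_of_le_one (abs_nonneg x) hx (by norm_num)
    exact ⟨by linarith, by linarith⟩
  · have h : ‖Complex.exp (x * Complex.I) - 1 - x * Complex.I + x ^ 2 / 2‖ ≤
        1 + 1 + |x| + x ^ 2 / 2 := by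
      refine (norm_add_le _ _).trans (add_le_add ((norm_sub_le _ _).trans
        (add_le_add ((norm_sub_le _ _).trans ?_) ?_)) ?_)
      · rw [Complex.norm_exp_ofReal_mul_I, norm_one]
      · simp
      · simp
    have h2 : |x| ≤ x ^ 2 := by rw [← sq_abs x]; nlinarith
    have h5 : x ^ 2 ≤ |x| ^ 3 := by
      rw [← sq_abs x]
      exact pow_le_pow_right₀ hx (by norm_num)
    exact ⟨by linarith, by linarith⟩

/-- A Lindeberg truncation at level `a`: the cubic bound serves for `|x| ≤ a`, the quadratic one
beyond. Keeping the minimum, and not only `|x| ^ (2 + δ)`, lets a merely almost surely finite moment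
bound suffice later. -/
lemma norm_cexp_taylor_two_le {a δ : ℝ} (ha : 0 < a) (ha1 : a ≤ 1) (hδ : 0 < δ)
    (x : ℝ) :
    ‖Complex.exp (x * Complex.I) - 1 - x * Complex.I + x ^ 2 / 2‖ ≤
      4 * (a * x ^ 2 + a ^ (-δ) * min (x ^ 2) (|x| ^ (2 + δ))) := by
  obtain ⟨h2, h3⟩ := norm_cexp_taylor_two_le_sq_and_cube x
  have hm : 0 ≤ min (x ^ 2) (|x| ^ (2 + δ)) := le_min (sq_nonneg x) (by positivity)
  have had : 0 < a ^ (-δ) := Real.rpow_pos_of_pos ha _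
  have hp := mul_nonneg had.le hm
  have hax : 0 ≤ a * x ^ 2 := by positivity
  rcases le_total |x| a with hx | hx
  · have : |x| ^ 3 ≤ a * x ^ 2 := by
      rw [pow_succ, sq_abs, mul_comm]
      gcongr
    linarith
  · have hx0 : 0 < |x| := ha.trans_le hx
    have h4 : x ^ 2 ≤ a ^ (-δ) * min (x ^ 2) (|x| ^ (2 + δ)) := by
      rw [mul_min_of_nonneg _ _ had.le]
      refine le_min ?_ ?_
      · have : 1 ≤ a ^ (-δ) := Real.one_le_rpow_of_pos_of_le_one_of_nonpos ha ha1 (by linarith)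
        nlinarith [sq_nonneg x]
      · rw [Real.rpow_add hx0, Real.rpow_two, sq_abs, Real.rpow_neg ha.le]
        have : a ^ δ ≤ |x| ^ δ := Real.rpow_le_rpow ha.le hx hδ.le
        have ha' : 0 < a ^ δ := Real.rpow_pos_of_pos ha _
        have : 1 ≤ (a ^ δ)⁻¹ * |x| ^ δ := by
          rw [inv_mul_eq_div, one_le_div ha']
          exact this
        nlinarith [sq_nonneg x]
    linarith

lemma abs_exp_neg_sub_one_add_le {v : ℝ} (hv : 0 ≤ v) : |Real.exp (-v) - (1 - v)| ≤ v ^ 2 := by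
  have h1 := Real.add_one_le_exp (-v)
  have h2 := Real.add_one_le_exp v
  have h3 : Real.exp (-v) * (1 + v) ≤ 1 := by
    have : Real.exp (-v) * Real.exp v = 1 := by rw [← Real.exp_add]; simp
    nlinarith [Real.exp_pos (-v)]
  -- Compare after multiplying by `1 + v`, since `(1 - v + v²)(1 + v) = 1 + v³ ≥ 1`.
  have h4 : Real.exp (-v) ≤ 1 - v + v ^ 2 := by
    by_contra! h
    have : 0 ≤ v ^ 3 := by positivity
    nlinarith
  rw [abs_le]
  constructor <;> nlinarith

/-! ### Conditional expectations -/

section Conditioning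

variable {Ω : Type*} {m mΩ : MeasurableSpace Ω} {P : Measure Ω} [IsProbabilityMeasure P]

/-- The measures with densities `X` and `P⁻[X | m]` agree on `m`, hence integrate `m`-measurable
functions alike. -/
lemma lintegral_mul_condLExp (hm : m ≤ mΩ) {g X : Ω → ℝ≥0∞} (hg : Measurable[m] g)
    (hX : Measurable X) : ∫⁻ ω, g ω * X ω ∂P = ∫⁻ ω, g ω * P⁻[X | m] ω ∂P := by
  have hG : Measurable P⁻[X | m] := measurable_condLExp' m P X
  have key : (P.withDensity X).trim hm = (P.withDensity P⁻[X | m]).trim hm := by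
    refine @Measure.ext _ m _ _ fun s hs => ?_
    rw [trim_measurableSet_eq hm hs, trim_measurableSet_eq hm hs, withDensity_apply _ (hm s hs),
      withDensity_apply _ (hm s hs), setLIntegral_condLExp hm P X hs]
  have h := congrArg (fun μ => @lintegral Ω m μ g) key
  simp only [lintegral_trim hm hg] at h
  rw [lintegral_withDensity_eq_lintegral_mul _ hX (hg.mono hm le_rfl),
    lintegral_withDensity_eq_lintegral_mul _ hG (hg.mono hm le_rfl)] at h
  simpa [mul_comm] using h

/-- Conditional Jensen for the concave function `min`: split on the `m`-measurable set where the
first conditional term is the smaller one. -/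
lemma lintegral_min_mul_le (hm : m ≤ mΩ) {g₁ g₂ X₁ X₂ : Ω → ℝ≥0∞} (hg₁ : Measurable[m] g₁)
    (hg₂ : Measurable[m] g₂) (hX₁ : Measurable X₁) (hX₂ : Measurable X₂) :
    ∫⁻ ω, min (g₁ ω * X₁ ω) (g₂ ω * X₂ ω) ∂P ≤
      ∫⁻ ω, min (g₁ ω * P⁻[X₁ | m] ω) (g₂ ω * P⁻[X₂ | m] ω) ∂P := by
  set A : Set Ω := {ω | g₁ ω * P⁻[X₁ | m] ω ≤ g₂ ω * P⁻[X₂ | m] ω} with hA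
  have hAm : MeasurableSet[m] A :=
    @measurableSet_le _ _ _ _ _ m _ _ _ _ _ (hg₁.mul (measurable_condLExp m P X₁))
      (hg₂.mul (measurable_condLExp m P X₂))
  have hB := hAm.compl
  have h₁ := lintegral_mul_condLExp (P := P) hm (hg₁.indicator hAm) hX₁
  have h₂ := lintegral_mul_condLExp (P := P) hm (hg₂.indicator hB) hX₂
  have e₁ : ∀ (s : Set Ω) (g X : Ω → ℝ≥0∞) ω,
      s.indicator g ω * X ω = s.indicator (fun ω => g ω * X ω) ω := by
    intro s g X ω
    by_cases h : ω ∈ s <;> simp [h]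
  simp only [e₁, lintegral_indicator (hm _ hAm), lintegral_indicator (hm _ hB)] at h₁ h₂
  rw [← lintegral_add_compl _ (hm _ hAm),
    ← lintegral_add_compl (fun ω => min (g₁ ω * P⁻[X₁ | m] ω) _) (hm _ hAm)]
  refine add_le_add ?_ ?_
  · calc _ ≤ ∫⁻ ω in A, g₁ ω * X₁ ω ∂P := lintegral_mono fun ω => min_le_left _ _
      _ = ∫⁻ ω in A, g₁ ω * P⁻[X₁ | m] ω ∂P := h₁
      _ = _ := setLIntegral_congr_fun (hm _ hAm) fun ω hω => (min_eq_left hω).symm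
  · calc _ ≤ ∫⁻ ω in Aᶜ, g₂ ω * X₂ ω ∂P := lintegral_mono fun ω => min_le_right _ _
      _ = ∫⁻ ω in Aᶜ, g₂ ω * P⁻[X₂ | m] ω ∂P := h₂
      _ = _ := setLIntegral_congr_fun (hm _ hB) fun ω hω =>
        (min_eq_right (lt_of_not_ge (show ¬ (g₁ ω * P⁻[X₁ | m] ω ≤ _) from hω)).le).symm

/-- The conditional expectation of a non-integrable function is `0` by convention, which a nonzero
constant rules out. -/
lemma integrable_of_condExp_eq_const {X : Ω → ℝ} {c : ℝ} (hc : c ≠ 0)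
    (h : P[X | m] =ᵐ[P] fun _ => c) : Integrable X P := by
  by_contra hX
  rw [condExp_of_not_integrable hX] at h
  obtain ⟨ω, hω⟩ := h.exists
  exact hc hω.symm

lemma condLExp_ofReal_eq_of_condExp_eq_const (hm : m ≤ mΩ) {X : Ω → ℝ} {c : ℝ}
    (hX : Integrable X P) (hX0 : 0 ≤ X) (h : P[X | m] =ᵐ[P] fun _ => c) :
    P⁻[fun ω => ENNReal.ofReal (X ω) | m] =ᵐ[P] fun _ => ENNReal.ofReal c := by
  refine (ae_eq_condLExp hm P _ measurable_const fun s hs => ?_).symm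
  have h1 := setIntegral_condExp hm hX hs
  rw [setIntegral_congr_ae (g := fun _ => c) (hm _ hs) (h.mono fun ω hω _ => hω)] at h1
  rw [← ofReal_integral_eq_lintegral_ofReal hX.integrableOn (ae_of_all _ hX0), ← h1]
  have hc0 : 0 ≤ c := by
    have := (condExp_nonneg (m := m) (ae_of_all P hX0)).trans_eq h
    obtain ⟨ω, hω⟩ := this.exists
    exact hω
  simp only [lintegral_const, integral_const, smul_eq_mul]
  rw [ENNReal.ofReal_mul (by positivity), mul_comm]
  simp

lemma integral_smul_eq_of_condExp_eq_const (hm : m ≤ mΩ) {X : Ω → ℝ} {c b : ℝ} {B : Ω → ℂ}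
    (hX : Integrable X P) (h : P[X | m] =ᵐ[P] fun _ => c) (hB : StronglyMeasurable[m] B)
    (hBb : ∀ ω, ‖B ω‖ ≤ b) : ∫ ω, X ω • B ω ∂P = ∫ ω, c • B ω ∂P := by
  have hi : Integrable (X • B) P :=
    hX.smul_bdd b (hB.mono hm).aestronglyMeasurable (ae_of_all _ hBb)
  have h1 := condExp_smul_of_aestronglyMeasurable_right (m := m) hX hi hB.aestronglyMeasurable
  change ∫ ω, (X • B) ω ∂P = _
  rw [← integral_condExp hm, integral_congr_ae h1]
  refine integral_congr_ae (h.mono fun ω hω => ?_)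
  simp [hω]

end Conditioning
-- One step of the martingale comparison
section Step

variable {Ω : Type*} {m mΩ : MeasurableSpace Ω} {P : Measure Ω} [IsProbabilityMeasure P]

/-- Given `m`, both `exp(iwξ)` and `exp(-w²/2)` have the expansion `1 - w²/2` up to the displayed
errors. The bound `b` on `w` is used only for integrability and does not enter the estimate. -/
lemma enorm_integral_mul_cexp_sub_le (hm : m ≤ mΩ) {ξ w : Ω → ℝ} {B : Ω → ℂ} {a δ c b : ℝ}
    (ha : 0 < a) (ha1 : a ≤ 1) (hδ : 0 < δ)
    (hξ : Measurable ξ) (hmean : P[ξ | m] =ᵐ[P] fun _ => 0)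
    (hvar : P[fun ω => ξ ω ^ 2 | m] =ᵐ[P] fun _ => 1)
    (hw : Measurable[m] w) (hwb : ∀ ω, |w ω| ≤ b)
    (hB : StronglyMeasurable[m] B) (hBc : ∀ ω, ‖B ω‖ ≤ c) :
    ‖∫ ω, B ω * (Complex.exp ((w ω * ξ ω : ℝ) * Complex.I) - Real.exp (-(w ω ^ 2 / 2))) ∂P‖ₑ ≤
      ENNReal.ofReal c * (ENNReal.ofReal (4 * a) * ∫⁻ ω, ENNReal.ofReal (w ω ^ 2) ∂P +
        ENNReal.ofReal (4 * a ^ (-δ)) *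
          ∫⁻ ω, ENNReal.ofReal (min ((w ω * ξ ω) ^ 2) (|w ω * ξ ω| ^ (2 + δ))) ∂P +
        ∫⁻ ω, ENNReal.ofReal (w ω ^ 4) ∂P) := by
  have hwm : Measurable w := hw.mono hm le_rfl
  have hBm : Measurable B := (hB.mono hm).measurable
  have hξ2 : Integrable (fun ω => ξ ω ^ 2) P := integrable_of_condExp_eq_const one_ne_zero hvar
  have hξ1 : Integrable ξ P :=
    ((memLp_two_iff_integrable_sq hξ.aestronglyMeasurable).2 hξ2).integrable (by norm_num)
  have hwc : StronglyMeasurable[m] fun ω => (w ω : ℂ) :=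
    (Complex.measurable_ofReal.comp hw).stronglyMeasurable
  have hwn : ∀ ω, ‖(w ω : ℂ)‖ ≤ b := fun ω => by simpa using hwb ω
  have hc0 : ∀ ω : Ω, 0 ≤ c := fun ω => (norm_nonneg _).trans (hBc ω)
  have hB1 : StronglyMeasurable[m] fun ω => B ω * w ω := hB.mul hwc
  have hB2 : StronglyMeasurable[m] fun ω => B ω * (w ω : ℂ) ^ 2 := hB.mul (hwc.pow 2)
  have hB1b : ∀ ω, ‖B ω * w ω‖ ≤ c * b := fun ω => by
    rw [norm_mul]
    exact mul_le_mul (hBc ω) (hwn ω) (norm_nonneg _) (hc0 ω)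
  have hB2b : ∀ ω, ‖B ω * (w ω : ℂ) ^ 2‖ ≤ c * b ^ 2 := fun ω => by
    rw [norm_mul, norm_pow]
    exact mul_le_mul (hBc ω) (pow_le_pow_left₀ (norm_nonneg _) (hwn ω) 2) (by positivity) (hc0 ω)
  have e1 := integral_smul_eq_of_condExp_eq_const hm hξ1 hmean hB1 hB1b
  have e2 := integral_smul_eq_of_condExp_eq_const hm hξ2 hvar hB2 hB2b
  have i1 : Integrable (fun ω => ξ ω • (B ω * w ω)) P :=
    hξ1.smul_bdd _ (hB1.mono hm).aestronglyMeasurable (ae_of_all _ hB1b)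
  have i2 : Integrable (fun ω => ξ ω ^ 2 • (B ω * (w ω : ℂ) ^ 2)) P :=
    hξ2.smul_bdd _ (hB2.mono hm).aestronglyMeasurable (ae_of_all _ hB2b)
  have i3 : Integrable (fun ω => B ω * (w ω : ℂ) ^ 2) P :=
    Integrable.of_bound (hB2.mono hm).aestronglyMeasurable _ (ae_of_all _ hB2b)
  have i0 : Integrable
      (fun ω => B ω * (Complex.exp ((w ω * ξ ω : ℝ) * Complex.I) - Real.exp (-(w ω ^ 2 / 2)))) P := by
    refine Integrable.of_bound (by fun_prop) (c * 2) (ae_of_all _ fun ω => ?_)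
    rw [norm_mul]
    refine mul_le_mul (hBc ω) ?_ (norm_nonneg _) (hc0 ω)
    refine (norm_sub_le _ _).trans ?_
    rw [Complex.norm_exp_ofReal_mul_I, Complex.norm_real, Real.norm_eq_abs, Real.abs_exp]
    have : Real.exp (-(w ω ^ 2 / 2)) ≤ 1 := Real.exp_le_one_iff.2 (by nlinarith [sq_nonneg (w ω)])
    linarith
  -- Inserting the linear and quadratic Taylor terms does not change the integral: conditionally `ξ`
  -- has mean `0` and `ξ²` has mean `1`.
  have key : ∫ ω, B ω * (Complex.exp ((w ω * ξ ω : ℝ) * Complex.I) - Real.exp (-(w ω ^ 2 / 2))) ∂P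
      = ∫ ω, B ω * ((Complex.exp ((w ω * ξ ω : ℝ) * Complex.I) - 1 - (w ω * ξ ω : ℝ) * Complex.I
          + (w ω * ξ ω : ℝ) ^ 2 / 2) - (Real.exp (-(w ω ^ 2 / 2)) - (1 - w ω ^ 2 / 2) : ℝ)) ∂P := by
    have e3 : (fun ω => B ω * ((Complex.exp ((w ω * ξ ω : ℝ) * Complex.I) - 1 -
          (w ω * ξ ω : ℝ) * Complex.I + (w ω * ξ ω : ℝ) ^ 2 / 2) -
          (Real.exp (-(w ω ^ 2 / 2)) - (1 - w ω ^ 2 / 2) : ℝ))) = fun ω =>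
        B ω * (Complex.exp ((w ω * ξ ω : ℝ) * Complex.I) - Real.exp (-(w ω ^ 2 / 2)))
        + ((ξ ω • (B ω * w ω)) * (-Complex.I) +
          (ξ ω ^ 2 • (B ω * (w ω : ℂ) ^ 2) - B ω * (w ω : ℂ) ^ 2) * (1 / 2)) := by
      ext ω
      simp only [Complex.real_smul]
      push_cast
      ring
    have j1 : Integrable (fun ω => (ξ ω • (B ω * w ω)) * (-Complex.I)) P := i1.mul_const _
    have j2 : Integrable (fun ω => (ξ ω ^ 2 • (B ω * (w ω : ℂ) ^ 2) - B ω * (w ω : ℂ) ^ 2) *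
      (1 / 2)) P := (i2.sub i3).mul_const _
    have j3 : Integrable (fun ω => (ξ ω • (B ω * w ω)) * (-Complex.I) +
      (ξ ω ^ 2 • (B ω * (w ω : ℂ) ^ 2) - B ω * (w ω : ℂ) ^ 2) * (1 / 2)) P := j1.add j2
    rw [e3, integral_add i0 j3, integral_add j1 j2, integral_mul_const,
      integral_mul_const, integral_sub i2 i3, e1, e2]
    simp
  rw [key]
  refine (enorm_integral_le_lintegral_enorm _).trans ?_
  have hpt : ∀ ω, ‖B ω * ((Complex.exp ((w ω * ξ ω : ℝ) * Complex.I) - 1 -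
          (w ω * ξ ω : ℝ) * Complex.I + (w ω * ξ ω : ℝ) ^ 2 / 2) -
          (Real.exp (-(w ω ^ 2 / 2)) - (1 - w ω ^ 2 / 2) : ℝ))‖ₑ ≤
      ENNReal.ofReal c * (ENNReal.ofReal (4 * a) * ENNReal.ofReal ((w ω * ξ ω) ^ 2) +
        ENNReal.ofReal (4 * a ^ (-δ)) *
          ENNReal.ofReal (min ((w ω * ξ ω) ^ 2) (|w ω * ξ ω| ^ (2 + δ))) +
        ENNReal.ofReal (w ω ^ 4)) := by
    intro ω
    have had : 0 < a ^ (-δ) := Real.rpow_pos_of_pos ha _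
    have hmn : 0 ≤ min ((w ω * ξ ω) ^ 2) (|w ω * ξ ω| ^ (2 + δ)) :=
      le_min (sq_nonneg _) (by positivity)
    rw [← ENNReal.ofReal_mul (by positivity), ← ENNReal.ofReal_mul (by positivity),
      ← ENNReal.ofReal_add (by positivity) (by positivity),
      ← ENNReal.ofReal_add (by positivity) (by positivity), ← ENNReal.ofReal_mul (hc0 ω),
      ← ofReal_norm]
    refine ENNReal.ofReal_le_ofReal ?_
    rw [norm_mul]
    refine mul_le_mul (hBc ω) ((norm_sub_le _ _).trans ?_) (norm_nonneg _) (hc0 ω)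
    have h1 := norm_cexp_taylor_two_le ha ha1 hδ (w ω * ξ ω)
    have h2 := abs_exp_neg_sub_one_add_le (v := w ω ^ 2 / 2) (by positivity)
    rw [Complex.norm_real, Real.norm_eq_abs]
    have : 0 ≤ w ω ^ 4 := by positivity
    nlinarith
  have hsq : ∫⁻ ω, ENNReal.ofReal ((w ω * ξ ω) ^ 2) ∂P = ∫⁻ ω, ENNReal.ofReal (w ω ^ 2) ∂P := by
    have hl := condLExp_ofReal_eq_of_condExp_eq_const hm hξ2 (fun ω => sq_nonneg (ξ ω)) hvar
    have := lintegral_mul_condLExp (P := P) hm (g := fun ω => ENNReal.ofReal (w ω ^ 2))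
      (X := fun ω => ENNReal.ofReal (ξ ω ^ 2)) (ENNReal.measurable_ofReal.comp (hw.pow_const 2))
      (by fun_prop)
    rw [lintegral_congr_ae (f := fun ω => ENNReal.ofReal (w ω ^ 2) * P⁻[_ | m] ω)
      (g := fun ω => ENNReal.ofReal (w ω ^ 2)) (hl.mono fun ω hω => by simp [hω])] at this
    rw [← this]
    refine lintegral_congr fun ω => ?_
    rw [mul_pow, ENNReal.ofReal_mul (sq_nonneg _)]
  refine (lintegral_mono hpt).trans_eq ?_
  rw [lintegral_const_mul _ (by fun_prop), lintegral_add_left (by fun_prop),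
    lintegral_add_left (by fun_prop), lintegral_const_mul _ (by fun_prop),
    lintegral_const_mul _ (by fun_prop), hsq]

/-- The bound `C` need not be `m`-measurable, so it is brought in only after conditioning. The
factor `w²` is left outside so that it can be summed over time. -/
lemma lintegral_min_sq_rpow_le (hm : m ≤ mΩ) {ξ w β : Ω → ℝ} {C : Ω → ℝ≥0∞} {δ : ℝ}
    (hδ : 0 < δ) (hξ : Measurable ξ) (hvar : P[fun ω => ξ ω ^ 2 | m] =ᵐ[P] fun _ => 1)
    (hC : P⁻[fun ω => ENNReal.ofReal (|ξ ω| ^ (2 + δ)) | m] ≤ᵐ[P] C)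
    (hw : Measurable[m] w) (hwβ : ∀ ω, |w ω| ≤ β ω) :
    ∫⁻ ω, ENNReal.ofReal (min ((w ω * ξ ω) ^ 2) (|w ω * ξ ω| ^ (2 + δ))) ∂P ≤
      ∫⁻ ω, ENNReal.ofReal (w ω ^ 2) * min 1 (ENNReal.ofReal (β ω ^ δ) * C ω) ∂P := by
  have hξ2 : Integrable (fun ω => ξ ω ^ 2) P := integrable_of_condExp_eq_const one_ne_zero hvar
  have hl := condLExp_ofReal_eq_of_condExp_eq_const hm hξ2 (fun ω => sq_nonneg (ξ ω)) hvar
  have hg2 : Measurable[m] fun ω => ENNReal.ofReal (|w ω| ^ (2 + δ)) := by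
    have : Measurable fun x : ℝ => ENNReal.ofReal (|x| ^ (2 + δ)) := by fun_prop
    exact this.comp hw
  have h := lintegral_min_mul_le (P := P) hm (g₁ := fun ω => ENNReal.ofReal (w ω ^ 2))
    (X₁ := fun ω => ENNReal.ofReal (ξ ω ^ 2)) (X₂ := fun ω => ENNReal.ofReal (|ξ ω| ^ (2 + δ)))
    (ENNReal.measurable_ofReal.comp (hw.pow_const 2)) hg2 (by fun_prop) (by fun_prop)
  refine (le_of_eq ?_).trans (h.trans (lintegral_mono_ae ?_))
  · refine lintegral_congr fun ω => ?_
    rw [ENNReal.ofReal_min, mul_pow, ENNReal.ofReal_mul (sq_nonneg _), abs_mul,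
      Real.mul_rpow (abs_nonneg _) (abs_nonneg _), ENNReal.ofReal_mul (by positivity)]
  · filter_upwards [hl, hC] with ω h1 h2
    rw [h1, ENNReal.ofReal_one, mul_one]
    rw [mul_min, mul_one, ← mul_assoc]
    refine min_le_min le_rfl (mul_le_mul' ?_ h2)
    rw [← ENNReal.ofReal_mul (sq_nonneg _)]
    refine ENNReal.ofReal_le_ofReal ?_
    rw [Real.rpow_add' (abs_nonneg _) (by linarith), Real.rpow_two, sq_abs]
    gcongr
    exact hwβ ω

end Step

/-! ### Integrals along sequences converging in probability -/

/-- Every subsequence has an almost surely convergent further subsequence, to which dominated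
convergence applies. The dependence of `g` on `ω` accommodates the random moment bound. -/
lemma tendsto_lintegral_of_tendstoInMeasure_const {Ω : Type*} {mΩ : MeasurableSpace Ω}
    {P : Measure Ω} [IsFiniteMeasure P] {X : ℕ → Ω → ℝ} {c : ℝ}
    (hX : TendstoInMeasure P X atTop fun _ => c) {g : Ω → ℝ → ℝ≥0∞} {D : ℝ≥0∞} (hD : D ≠ ∞)
    (hg : ∀ n, AEMeasurable (fun ω => g ω (X n ω)) P) (hgD : ∀ n ω, g ω (X n ω) ≤ D)
    (hlim : ∀ᵐ ω ∂P, Tendsto (g ω) (𝓝 c) (𝓝 0)) :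
    Tendsto (fun n => ∫⁻ ω, g ω (X n ω) ∂P) atTop (𝓝 0) := by
  refine tendsto_of_subseq_tendsto fun ns hns => ?_
  obtain ⟨ms, -, hms⟩ := (hX.comp hns).exists_seq_tendsto_ae
  refine ⟨ms, ?_⟩
  have := tendsto_lintegral_of_dominated_convergence' (μ := P)
    (F := fun n ω => g ω (X (ns (ms n)) ω)) (f := fun _ => 0) (fun _ => D) (fun n => hg _)
    (fun n => ae_of_all _ fun ω => hgD _ ω) (by simpa using ENNReal.mul_ne_top hD (measure_ne_top _ _))
    (by filter_upwards [hms, hlim] with ω h1 h2 using h2.comp h1)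
  simpa using this

lemma sum_lintegral_ofReal_sq_mul_le {Ω : Type*} {mΩ : MeasurableSpace Ω} {P : Measure Ω}
    {s : Finset ℕ} {w : ℕ → Ω → ℝ} {G : Ω → ℝ≥0∞} {U : ℝ}
    (hw : ∀ t ∈ s, Measurable (w t)) (hG : Measurable G)
    (hU : ∀ ω, ∑ t ∈ s, w t ω ^ 2 ≤ U) :
    ∑ t ∈ s, ∫⁻ ω, ENNReal.ofReal (w t ω ^ 2) * G ω ∂P ≤ ENNReal.ofReal U * ∫⁻ ω, G ω ∂P := by
  rw [← lintegral_finsetSum' s fun t ht => by have := hw t ht; fun_prop,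
    ← lintegral_const_mul _ hG]
  refine lintegral_mono fun ω => ?_
  simp only []
  rw [← Finset.sum_mul, ← ENNReal.ofReal_sum_of_nonneg fun t _ => sq_nonneg (w t ω)]
  gcongr
  exact hU ω

/-! ### Martingale central limit theorem -/

section MartingaleCLT

variable {Ω : Type*} {mΩ : MeasurableSpace Ω} {P : Measure Ω} [IsProbabilityMeasure P]

lemma enorm_integral_cexp_sub_one_le {ℱ : Filtration ℕ mΩ} {n : ℕ} {ξ w : ℕ → Ω → ℝ}
    {β : Ω → ℝ} {C : Ω → ℝ≥0∞} {U a δ : ℝ} (ha : 0 < a) (ha1 : a ≤ 1) (hδ : 0 < δ)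
    (hξ : ∀ t ∈ Finset.Icc 1 n, Measurable[ℱ t] (ξ t))
    (hmean : ∀ t ∈ Finset.Icc 1 n, P[ξ t | ℱ (t - 1)] =ᵐ[P] fun _ => 0)
    (hvar : ∀ t ∈ Finset.Icc 1 n, P[fun ω => ξ t ω ^ 2 | ℱ (t - 1)] =ᵐ[P] fun _ => 1)
    (hC : ∀ t ∈ Finset.Icc 1 n,
      P⁻[fun ω => ENNReal.ofReal (|ξ t ω| ^ (2 + δ)) | ℱ (t - 1)] ≤ᵐ[P] C)
    (hCm : Measurable C)
    (hw : ∀ t ∈ Finset.Icc 1 n, Measurable[ℱ (t - 1)] (w t))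
    (hwβ : ∀ t ∈ Finset.Icc 1 n, ∀ ω, |w t ω| ≤ β ω) (hβ : Measurable β)
    (hU : ∀ ω, ∑ t ∈ Finset.Icc 1 n, w t ω ^ 2 ≤ U) :
    ‖∫ ω, Complex.exp ((∑ t ∈ Finset.Icc 1 n, w t ω * ξ t ω : ℝ) * Complex.I +
        ((∑ t ∈ Finset.Icc 1 n, w t ω ^ 2) / 2 : ℝ)) ∂P - 1‖ₑ ≤
      ENNReal.ofReal (Real.exp (U / 2)) * (ENNReal.ofReal (4 * a) * ENNReal.ofReal U +
        ENNReal.ofReal (4 * a ^ (-δ)) *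
          (ENNReal.ofReal U * ∫⁻ ω, min 1 (ENNReal.ofReal (β ω ^ δ) * C ω) ∂P) +
        ENNReal.ofReal U * ∫⁻ ω, ENNReal.ofReal (min U (β ω ^ 2)) ∂P) := by
  set S : ℕ → Ω → ℝ := fun m ω => ∑ t ∈ Finset.Icc 1 m, w t ω * ξ t ω with hS
  set V : ℕ → Ω → ℝ := fun m ω => ∑ t ∈ Finset.Icc 1 m, w t ω ^ 2 with hV
  have hsub : ∀ {m}, m ≤ n → ∀ t ∈ Finset.Icc 1 m, t ∈ Finset.Icc 1 n := fun hm t ht =>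
    Finset.Icc_subset_Icc_right hm ht
  have hVU : ∀ m ≤ n, ∀ ω, V m ω ≤ U := fun m hm ω =>
    (Finset.sum_le_sum_of_subset_of_nonneg (Finset.Icc_subset_Icc_right hm)
      fun _ _ _ => sq_nonneg _).trans (hU ω)
  have hwU : ∀ t ∈ Finset.Icc 1 n, ∀ ω, w t ω ^ 2 ≤ U := fun t ht ω =>
    (Finset.single_le_sum (f := fun t => w t ω ^ 2) (fun _ _ => sq_nonneg _) ht).trans (hU ω)
  have hSm : ∀ m ≤ n, Measurable[ℱ m] (S m) := fun m hm => by
    refine Finset.measurable_fun_sum _ fun t ht => ?_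
    have h2 := (Finset.mem_Icc.1 ht).2
    exact ((hw t (hsub hm t ht)).mono (ℱ.mono (by omega)) le_rfl).mul
      ((hξ t (hsub hm t ht)).mono (ℱ.mono h2) le_rfl)
  -- Predictability: `V m` is already known at time `m - 1`.
  have hVm : ∀ m k, m ≤ n → m ≤ k + 1 → Measurable[ℱ k] (V m) := fun m k hm hk => by
    refine Finset.measurable_fun_sum _ fun t ht => ?_
    have h2 := (Finset.mem_Icc.1 ht).2
    exact ((hw t (hsub hm t ht)).mono (ℱ.mono (by omega)) le_rfl).pow_const 2
  have hwm : ∀ t ∈ Finset.Icc 1 n, Measurable (w t) := fun t ht => (hw t ht).mono (ℱ.le _) le_rfl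
  set T : ℕ → Ω → ℂ := fun m ω => Complex.exp ((S m ω : ℝ) * Complex.I + (V m ω / 2 : ℝ)) with hT
  have hnorm : ∀ x y : ℝ, ‖Complex.exp (x * Complex.I + y)‖ = Real.exp y := fun x y => by
    rw [Complex.exp_add, norm_mul, Complex.norm_exp_ofReal_mul_I, one_mul, ← Complex.ofReal_exp,
      Complex.norm_real, Real.norm_eq_abs, Real.abs_exp]
  have hTint : ∀ m ≤ n, Integrable (T m) P := fun m hm => by
    have h1 : Measurable (S m) := (hSm m hm).mono (ℱ.le _) le_rfl
    have h2 : Measurable (V m) := (hVm m m hm (by omega)).mono (ℱ.le _) le_rfl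
    refine Integrable.of_bound (by fun_prop) (Real.exp (U / 2)) (ae_of_all _ fun ω => ?_)
    rw [hT, hnorm]
    have := hVU m hm ω
    gcongr
  set e : ℕ → ℝ≥0∞ := fun t => ENNReal.ofReal (Real.exp (U / 2)) *
    (ENNReal.ofReal (4 * a) * ∫⁻ ω, ENNReal.ofReal (w t ω ^ 2) ∂P +
      ENNReal.ofReal (4 * a ^ (-δ)) *
        ∫⁻ ω, ENNReal.ofReal (w t ω ^ 2) * min 1 (ENNReal.ofReal (β ω ^ δ) * C ω) ∂P +
      ∫⁻ ω, ENNReal.ofReal (w t ω ^ 2) * ENNReal.ofReal (min U (β ω ^ 2)) ∂P) with he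
  have step : ∀ m, m + 1 ≤ n → ‖∫ ω, T (m + 1) ω ∂P - ∫ ω, T m ω ∂P‖ₑ ≤ e (m + 1) := by
    intro m hm
    have ht : m + 1 ∈ Finset.Icc 1 n := by simp [hm]
    -- Pairing `S m` with `V (m + 1)` keeps `B` measurable at time `m`; then `T (m + 1) = B
    -- exp(iwξ)` and `T m = B exp(-w²/2)`.
    set B : Ω → ℂ := fun ω => Complex.exp ((S m ω : ℝ) * Complex.I + (V (m + 1) ω / 2 : ℝ))
      with hB
    have hSs : ∀ ω, S (m + 1) ω = S m ω + w (m + 1) ω * ξ (m + 1) ω := fun ω => by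
      simp only [hS]
      rw [Finset.sum_Icc_succ_top (by omega)]
    have hVs : ∀ ω, V (m + 1) ω = V m ω + w (m + 1) ω ^ 2 := fun ω => by
      simp only [hV]
      rw [Finset.sum_Icc_succ_top (by omega)]
    have hBm : StronglyMeasurable[ℱ m] B := by
      have h1 := hSm m (by omega)
      have h2 := hVm (m + 1) m hm le_rfl
      have h3 : Measurable fun p : ℝ × ℝ => Complex.exp (p.1 * Complex.I + (p.2 / 2 : ℝ)) := by
        fun_prop
      exact (h3.comp (h1.prodMk h2)).stronglyMeasurable
    rw [← integral_sub (hTint _ hm) (hTint _ (by omega))]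
    have hdiff : (fun ω => T (m + 1) ω - T m ω) = fun ω => B ω *
        (Complex.exp ((w (m + 1) ω * ξ (m + 1) ω : ℝ) * Complex.I) -
          Real.exp (-(w (m + 1) ω ^ 2 / 2))) := by
      ext ω
      simp only [hT, hB, mul_sub, Complex.ofReal_exp, ← Complex.exp_add, hSs, hVs]
      push_cast
      congr 2 <;> ring
    rw [hdiff]
    refine (enorm_integral_mul_cexp_sub_le (ℱ.le m) (b := √U) ha ha1 hδ
      ((hξ _ ht).mono (ℱ.le _) le_rfl) (hmean _ ht) (hvar _ ht) (hw _ ht)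
      (fun ω => Real.abs_le_sqrt (hwU _ ht ω)) hBm (c := Real.exp (U / 2)) fun ω => ?_).trans ?_
    · rw [hB, hnorm]
      have := hVU _ hm ω
      gcongr
    · simp only [he]
      gcongr ENNReal.ofReal _ * (_ + _ * ?_ + ?_)
      · exact lintegral_min_sq_rpow_le (ℱ.le m) hδ ((hξ _ ht).mono (ℱ.le _) le_rfl) (hvar _ ht)
          (hC _ ht) (hw _ ht) (hwβ _ ht)
      · refine lintegral_mono fun ω => ?_
        simp only []
        rw [← ENNReal.ofReal_mul (sq_nonneg _)]
        refine ENNReal.ofReal_le_ofReal ?_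
        rw [show w (m + 1) ω ^ 4 = w (m + 1) ω ^ 2 * w (m + 1) ω ^ 2 by ring]
        gcongr
        refine le_min (hwU _ ht ω) ?_
        rw [← sq_abs]
        exact pow_le_pow_left₀ (abs_nonneg _) (hwβ _ ht ω) 2
  have hall : ∀ m ≤ n, ‖∫ ω, T m ω ∂P - 1‖ₑ ≤ ∑ t ∈ Finset.Icc 1 m, e t := by
    intro m
    induction m with
    | zero => simp [hT, hS, hV]
    | succ m ih =>
      intro hm
      rw [Finset.sum_Icc_succ_top (by omega), add_comm (Finset.sum _ _),
        ← sub_add_sub_cancel (∫ ω, T (m + 1) ω ∂P) (∫ ω, T m ω ∂P) 1]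
      exact (enorm_add_le _ _).trans (add_le_add (step m hm) (ih (by omega)))
  refine (hall n le_rfl).trans ?_
  simp only [he]
  rw [← Finset.mul_sum, Finset.sum_add_distrib, Finset.sum_add_distrib, ← Finset.mul_sum,
    ← Finset.mul_sum]
  gcongr
  · simpa using sum_lintegral_ofReal_sq_mul_le (P := P) hwm (G := fun _ => 1) measurable_const hU
  · exact sum_lintegral_ofReal_sq_mul_le hwm (by fun_prop) hU
  · exact sum_lintegral_ofReal_sq_mul_le hwm (by fun_prop) hU

/-- A martingale central limit theorem for predictably weighted sums of martingale differences with
unit conditional variance, under a conditional Lyapunov condition. -/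
theorem tendstoInDistribution_sum_mul {ℱ : ℕ → Filtration ℕ mΩ} {ξ v : ℕ → ℕ → Ω → ℝ}
    {b : ℕ → Ω → ℝ} {C : Ω → ℝ≥0∞} {δ : ℝ} (hδ : 0 < δ)
    (hξ : ∀ n, ∀ t ∈ Finset.Icc 1 n, Measurable[ℱ n t] (ξ n t))
    (hmean : ∀ n, ∀ t ∈ Finset.Icc 1 n, P[ξ n t | ℱ n (t - 1)] =ᵐ[P] fun _ => 0)
    (hvar : ∀ n, ∀ t ∈ Finset.Icc 1 n, P[fun ω => ξ n t ω ^ 2 | ℱ n (t - 1)] =ᵐ[P] fun _ => 1)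
    (hC : ∀ n, ∀ t ∈ Finset.Icc 1 n,
      P⁻[fun ω => ENNReal.ofReal (|ξ n t ω| ^ (2 + δ)) | ℱ n (t - 1)] ≤ᵐ[P] C)
    (hCm : Measurable C) (hCfin : ∀ᵐ ω ∂P, C ω < ∞)
    (hv : ∀ n, ∀ t ∈ Finset.Icc 1 n, Measurable[ℱ n (t - 1)] (v n t))
    (hvb : ∀ n, ∀ t ∈ Finset.Icc 1 n, ∀ ω, |v n t ω| ≤ b n ω) (hbm : ∀ n, Measurable (b n))
    (hb : TendstoInMeasure P b atTop fun _ => 0)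
    (hv1 : ∀ n ω, ∑ t ∈ Finset.Icc 1 n, v n t ω ^ 2 ≤ 1)
    (hV : TendstoInMeasure P (fun n ω => ∑ t ∈ Finset.Icc 1 n, v n t ω ^ 2) atTop fun _ => 1) :
    TendstoInDistribution (fun n ω => ∑ t ∈ Finset.Icc 1 n, v n t ω * ξ n t ω) atTop id
      (fun _ => P) (gaussianReal 0 1) := by
  have hξm : ∀ n, ∀ t ∈ Finset.Icc 1 n, Measurable (ξ n t) := fun n t ht =>
    (hξ n t ht).mono ((ℱ n).le _) le_rfl
  have hvm : ∀ n, ∀ t ∈ Finset.Icc 1 n, Measurable (v n t) := fun n t ht =>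
    (hv n t ht).mono ((ℱ n).le _) le_rfl
  set S : ℕ → Ω → ℝ := fun n ω => ∑ t ∈ Finset.Icc 1 n, v n t ω * ξ n t ω with hS
  set V : ℕ → Ω → ℝ := fun n ω => ∑ t ∈ Finset.Icc 1 n, v n t ω ^ 2 with hVdef
  have hSm : ∀ n, Measurable (S n) := fun n =>
    Finset.measurable_fun_sum _ fun t ht => (hvm n t ht).mul (hξm n t ht)
  have hVm : ∀ n, Measurable (V n) := fun n =>
    Finset.measurable_fun_sum _ fun t ht => (hvm n t ht).pow_const 2
  refine ⟨fun n => (hSm n).aemeasurable, by fun_prop, ?_⟩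
  refine ProbabilityMeasure.tendsto_iff_tendsto_charFun.2 fun u => ?_
  simp only [ProbabilityMeasure.coe_mk, Measure.map_id, charFun_gaussianReal]
  have hcf : ∀ n, charFun (P.map (S n)) u = ∫ ω, Complex.exp ((u * S n ω : ℝ) * Complex.I) ∂P := by
    intro n
    rw [charFun_apply_real, integral_map (hSm n).aemeasurable (by fun_prop)]
    simp
  simp only [hcf]
  set T : ℕ → Ω → ℂ := fun n ω =>
    Complex.exp ((u * S n ω : ℝ) * Complex.I + (u ^ 2 * V n ω / 2 : ℝ)) with hT
  have hbound : ∀ a, 0 < a → a ≤ 1 → ∀ n, ‖∫ ω, T n ω ∂P - 1‖ₑ ≤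
      ENNReal.ofReal (Real.exp (u ^ 2 / 2)) * (ENNReal.ofReal (4 * a) * ENNReal.ofReal (u ^ 2) +
        ENNReal.ofReal (4 * a ^ (-δ)) * (ENNReal.ofReal (u ^ 2) *
          ∫⁻ ω, min 1 (ENNReal.ofReal (|u * b n ω| ^ δ) * C ω) ∂P) +
        ENNReal.ofReal (u ^ 2) * ∫⁻ ω, ENNReal.ofReal (min (u ^ 2) (|u * b n ω| ^ 2)) ∂P) := by
    intro a ha ha1 n
    have h := enorm_integral_cexp_sub_one_le (P := P) (ℱ := ℱ n) (n := n) (ξ := ξ n)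
      (w := fun t ω => u * v n t ω) (β := fun ω => |u * b n ω|) (C := C) (U := u ^ 2) ha ha1 hδ
      (hξ n) (hmean n) (hvar n) (hC n) hCm (fun t ht => (hv n t ht).const_mul u)
      (fun t ht ω => by
        rw [abs_mul, abs_mul]
        exact mul_le_mul_of_nonneg_left ((hvb n t ht ω).trans (le_abs_self _)) (abs_nonneg u))
      (by have := hbm n; fun_prop)
      (fun ω => by
        simp only [mul_pow, ← Finset.mul_sum]
        nlinarith [hv1 n ω, sq_nonneg u])
    simpa only [mul_pow, mul_assoc, ← Finset.mul_sum, hT, hS, hVdef] using h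
  have hq : Tendsto (fun n => ∫⁻ ω, min 1 (ENNReal.ofReal (|u * b n ω| ^ δ) * C ω) ∂P) atTop
      (𝓝 0) := by
    refine tendsto_lintegral_of_tendstoInMeasure_const hb
      (g := fun ω x => min 1 (ENNReal.ofReal (|u * x| ^ δ) * C ω)) ENNReal.one_ne_top
      (fun n => by have := hbm n; fun_prop) (fun _ _ => min_le_left _ _) ?_
    filter_upwards [hCfin] with ω hω
    have h1 : Tendsto (fun x : ℝ => |u * x| ^ δ) (𝓝 0) (𝓝 0) := by
      have : Continuous fun x : ℝ => |u * x| ^ δ :=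
        (by fun_prop : Continuous fun x : ℝ => |u * x|).rpow_const fun _ => Or.inr hδ.le
      simpa [Real.zero_rpow hδ.ne'] using this.tendsto 0
    have h2 := ENNReal.Tendsto.mul_const (b := C ω) (ENNReal.tendsto_ofReal h1) (Or.inr hω.ne)
    have h3 := (tendsto_const_nhds (x := (1 : ℝ≥0∞))).min h2
    simpa using h3
  have hr : Tendsto (fun n => ∫⁻ ω, ENNReal.ofReal (min (u ^ 2) (|u * b n ω| ^ 2)) ∂P) atTop
      (𝓝 0) := by
    refine tendsto_lintegral_of_tendstoInMeasure_const hb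
      (g := fun _ x => ENNReal.ofReal (min (u ^ 2) (|u * x| ^ 2))) (D := ENNReal.ofReal (u ^ 2))
      ENNReal.ofReal_ne_top (fun n => by have := hbm n; fun_prop)
      (fun _ _ => ENNReal.ofReal_le_ofReal (min_le_left _ _)) (ae_of_all _ fun ω => ?_)
    have : Continuous fun x : ℝ => ENNReal.ofReal (min (u ^ 2) (|u * x| ^ 2)) :=
      ENNReal.continuous_ofReal.comp (by fun_prop)
    simpa [sq_nonneg] using this.tendsto 0
  have hT1 : Tendsto (fun n => ∫ ω, T n ω ∂P) atTop (𝓝 1) := by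
    rw [← tendsto_sub_nhds_zero_iff, tendsto_zero_iff_enorm_tendsto_zero]
    refine ENNReal.tendsto_nhds_zero.2 fun ε hε => ?_
    have hε2 : 0 < ε / 2 := ENNReal.half_pos hε.ne'
    -- The truncation level is fixed first, making the term without decay in `n` small; the other
    -- terms, with their factor `a ^ (-δ)`, vanish as `n → ∞`.
    obtain ⟨a, ⟨ha, ha1⟩, hae⟩ : ∃ a : ℝ, (0 < a ∧ a ≤ 1) ∧ ENNReal.ofReal (Real.exp (u ^ 2 / 2)) *
        (ENNReal.ofReal (4 * a) * ENNReal.ofReal (u ^ 2)) ≤ ε / 2 := by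
      have h1 : Tendsto (fun a : ℝ => ENNReal.ofReal (Real.exp (u ^ 2 / 2)) *
          (ENNReal.ofReal (4 * a) * ENNReal.ofReal (u ^ 2))) (𝓝[>] 0) (𝓝 0) := by
        have h0 : Tendsto (fun a : ℝ => ENNReal.ofReal (4 * a)) (𝓝 0) (𝓝 0) := by
          have : Continuous fun a : ℝ => ENNReal.ofReal (4 * a) :=
            ENNReal.continuous_ofReal.comp (by fun_prop)
          simpa using this.tendsto 0
        have := ENNReal.Tendsto.const_mul (a := ENNReal.ofReal (Real.exp (u ^ 2 / 2)))
          (ENNReal.Tendsto.mul_const (b := ENNReal.ofReal (u ^ 2)) h0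
            (Or.inr ENNReal.ofReal_ne_top)) (Or.inr ENNReal.ofReal_ne_top)
        simpa using this.mono_left nhdsWithin_le_nhds
      have h2 : ∀ᶠ a : ℝ in 𝓝[>] 0, 0 < a ∧ a ≤ 1 := by
        filter_upwards [Ioc_mem_nhdsGT (zero_lt_one' ℝ)] with a ha using ha
      exact (h2.and (ENNReal.tendsto_nhds_zero.1 h1 _ hε2)).exists
    have hrest : Tendsto (fun n => ENNReal.ofReal (Real.exp (u ^ 2 / 2)) *
        (ENNReal.ofReal (4 * a ^ (-δ)) * (ENNReal.ofReal (u ^ 2) *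
          ∫⁻ ω, min 1 (ENNReal.ofReal (|u * b n ω| ^ δ) * C ω) ∂P) +
        ENNReal.ofReal (u ^ 2) * ∫⁻ ω, ENNReal.ofReal (min (u ^ 2) (|u * b n ω| ^ 2)) ∂P))
        atTop (𝓝 0) := by
      have h1 := ENNReal.Tendsto.const_mul (a := ENNReal.ofReal (4 * a ^ (-δ)))
        (ENNReal.Tendsto.const_mul (a := ENNReal.ofReal (u ^ 2)) hq (Or.inr ENNReal.ofReal_ne_top))
        (Or.inr ENNReal.ofReal_ne_top)
      have h2 := ENNReal.Tendsto.const_mul (a := ENNReal.ofReal (u ^ 2)) hr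
        (Or.inr ENNReal.ofReal_ne_top)
      simpa using ENNReal.Tendsto.const_mul (a := ENNReal.ofReal (Real.exp (u ^ 2 / 2)))
        (h1.add h2) (Or.inr ENNReal.ofReal_ne_top)
    filter_upwards [ENNReal.tendsto_nhds_zero.1 hrest _ hε2] with n hn
    refine (hbound a ha ha1 n).trans ?_
    rw [add_assoc, mul_add]
    exact (add_le_add hae hn).trans_eq (ENNReal.add_halves ε)
  -- The cost of replacing `V` by `1`: `T - R = exp(iuS) exp(u²/2)`.
  set R : ℕ → Ω → ℂ := fun n ω => Complex.exp ((u * S n ω : ℝ) * Complex.I) *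
    (Real.exp (u ^ 2 * V n ω / 2) - Real.exp (u ^ 2 / 2) : ℝ) with hR
  have hexpV : ∀ n ω, |Real.exp (u ^ 2 * V n ω / 2) - Real.exp (u ^ 2 / 2)| ≤
      Real.exp (u ^ 2 / 2) := by
    intro n ω
    have h1 : Real.exp (u ^ 2 * V n ω / 2) ≤ Real.exp (u ^ 2 / 2) := by
      have : u ^ 2 * V n ω ≤ u ^ 2 := mul_le_of_le_one_right (sq_nonneg _) (hv1 n ω)
      gcongr
    rw [abs_le]
    constructor <;> linarith [Real.exp_pos (u ^ 2 * V n ω / 2), Real.exp_pos (u ^ 2 / 2)]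
  have hRn : ∀ n ω, ‖R n ω‖ = |Real.exp (u ^ 2 * V n ω / 2) - Real.exp (u ^ 2 / 2)| := by
    intro n ω
    rw [hR, norm_mul, Complex.norm_exp_ofReal_mul_I, one_mul, Complex.norm_real, Real.norm_eq_abs]
  have hR0 : Tendsto (fun n => ∫ ω, R n ω ∂P) atTop (𝓝 0) := by
    rw [tendsto_zero_iff_enorm_tendsto_zero]
    have h := tendsto_lintegral_of_tendstoInMeasure_const hV
      (g := fun _ x => ENNReal.ofReal |Real.exp (u ^ 2 * x / 2) - Real.exp (u ^ 2 / 2)|)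
      (D := ENNReal.ofReal (Real.exp (u ^ 2 / 2))) ENNReal.ofReal_ne_top
      (fun n => by have := hVm n; fun_prop)
      (fun n ω => ENNReal.ofReal_le_ofReal (hexpV n ω))
      (ae_of_all _ fun ω => by
        have : Continuous fun x : ℝ =>
          ENNReal.ofReal |Real.exp (u ^ 2 * x / 2) - Real.exp (u ^ 2 / 2)| :=
          ENNReal.continuous_ofReal.comp (by fun_prop)
        simpa using this.tendsto 1)
    refine tendsto_of_tendsto_of_tendsto_of_le_of_le tendsto_const_nhds h (fun _ => zero_le)
      fun n => (enorm_integral_le_lintegral_enorm _).trans_eq (lintegral_congr fun ω => ?_)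
    rw [← ofReal_norm, hRn]
  have hlim := (hT1.sub hR0).mul_const (Complex.exp (-(u ^ 2 / 2)))
  rw [sub_zero, one_mul] at hlim
  have hRint : ∀ n, Integrable (R n) P := fun n => by
    have h1 := hSm n
    have h2 := hVm n
    exact Integrable.of_bound (by fun_prop) _ (ae_of_all _ fun ω => (hRn n ω).trans_le (hexpV n ω))
  have hTint : ∀ n, Integrable (T n) P := fun n => by
    have h1 := hSm n
    have h2 := hVm n
    refine Integrable.of_bound (by fun_prop) (Real.exp (u ^ 2 / 2)) (ae_of_all _ fun ω => ?_)
    simp only [hT]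
    rw [Complex.exp_add, norm_mul, Complex.norm_exp_ofReal_mul_I, one_mul,
      ← Complex.ofReal_exp, Complex.norm_real, Real.norm_eq_abs, Real.abs_exp]
    have : u ^ 2 * V n ω ≤ u ^ 2 := mul_le_of_le_one_right (sq_nonneg _) (hv1 n ω)
    gcongr
  convert hlim using 2 with n
  · rw [← integral_sub (hTint n) (hRint n), ← integral_mul_const]
    refine integral_congr_ae (ae_of_all _ fun ω => ?_)
    simp only [hT, hR, Complex.exp_add]
    rw [← mul_sub, mul_assoc]
    push_cast
    rw [sub_sub_cancel, ← Complex.exp_add]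
    simp
  · simp

end MartingaleCLT

/-! ### Riemann sums along the pulls of one arm -/

section RiemannSum

variable {s₀ : ℝ} {z : ℕ → ℝ}

lemma one_le_partialSum_div (hs₀ : 0 < s₀) (m : ℕ) : 1 ≤ partialSum s₀ z m / s₀ := by
  rw [one_le_div hs₀, partialSum]
  have : 0 ≤ ∑ i ∈ Finset.Icc 1 m, z i ^ 2 := Finset.sum_nonneg fun _ _ => sq_nonneg _
  linarith

lemma partialSum_succ_div (m : ℕ) :
    partialSum s₀ z (m + 1) / s₀ = partialSum s₀ z m / s₀ + z (m + 1) ^ 2 / s₀ := by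
  rw [partialSum, partialSum, Finset.sum_Icc_succ_top (by omega)]
  ring

lemma intervalIntegrable_of_antitoneOn {g : ℝ → ℝ} (hg : AntitoneOn g (Set.Ici 1)) {a b : ℝ}
    (ha : 1 ≤ a) (hb : 1 ≤ b) : IntervalIntegrable g volume a b :=
  (hg.mono fun _ hx => (le_min ha hb).trans hx.1).intervalIntegrable

/-- On a pull, the integral over the new cell lies between its right- and left-endpoint values times
`1 / s₀`, and these gaps telescope. Other times change neither the sum nor the integral. -/
lemma riemannSum_le_integral_le {g : ℝ → ℝ} (hg : AntitoneOn g (Set.Ici 1)) (hs₀ : 0 < s₀)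
    {n : ℕ} (hz : ∀ t ∈ Finset.Icc 1 n, z t ^ 2 = 0 ∨ z t ^ 2 = 1) :
    ∑ t ∈ Finset.Icc 1 n, g (partialSum s₀ z t / s₀) * (z t ^ 2 / s₀) ≤
        ∫ u in (1 : ℝ)..partialSum s₀ z n / s₀, g u ∧
      ∫ u in (1 : ℝ)..partialSum s₀ z n / s₀, g u ≤
        ∑ t ∈ Finset.Icc 1 n, g (partialSum s₀ z t / s₀) * (z t ^ 2 / s₀) +
          (g 1 - g (partialSum s₀ z n / s₀)) / s₀ := by
  induction n with
  | zero => simp [partialSum, hs₀.ne']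
  | succ n ih =>
    obtain ⟨h1, h2⟩ := ih fun t ht => hz t (Finset.Icc_subset_Icc_right (by omega) ht)
    rw [Finset.sum_Icc_succ_top (by omega)]
    have hr := one_le_partialSum_div (z := z) hs₀ n
    have hr' := one_le_partialSum_div (z := z) hs₀ (n + 1)
    have hsucc := partialSum_succ_div (s₀ := s₀) (z := z) n
    set r := partialSum s₀ z n / s₀
    set r' := partialSum s₀ z (n + 1) / s₀
    rcases hz (n + 1) (by simp) with h0 | h0
    · rw [h0, zero_div, add_zero] at hsucc
      rw [h0, hsucc]
      simpa using ⟨h1, h2⟩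
    · rw [h0] at hsucc ⊢
      have hrr : r ≤ r' := by
        rw [hsucc]
        have : 0 < 1 / s₀ := by positivity
        linarith
      rw [← intervalIntegral.integral_add_adjacent_intervals
        (intervalIntegrable_of_antitoneOn hg le_rfl hr) (intervalIntegrable_of_antitoneOn hg hr hr')]
      have hlen : r' - r = 1 / s₀ := by rw [hsucc]; ring
      have hlow : g r' * (1 / s₀) ≤ ∫ u in r..r', g u := by
        have := intervalIntegral.integral_mono_on hrr intervalIntegrable_const
          (intervalIntegrable_of_antitoneOn hg hr hr') (f := fun _ => g r')
          fun u hu => hg (hr.trans hu.1) hr' hu.2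
        rwa [intervalIntegral.integral_const, hlen, smul_eq_mul, mul_comm] at this
      have hup : ∫ u in r..r', g u ≤ g r * (1 / s₀) := by
        have := intervalIntegral.integral_mono_on hrr
          (intervalIntegrable_of_antitoneOn hg hr hr') intervalIntegrable_const (g := fun _ => g r)
          fun u hu => hg hr (hr.trans hu.1) hu.1
        rwa [intervalIntegral.integral_const, hlen, smul_eq_mul, mul_comm] at this
      refine ⟨add_le_add h1 hlow, ?_⟩
      have e : (g 1 - g r) / s₀ + g r * (1 / s₀) = g r' * (1 / s₀) + (g 1 - g r') / s₀ := by ring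
      linarith

lemma sum_weight_sq {f : ℝ → ℝ} (hs₀ : 0 < s₀) (n : ℕ) :
    ∑ t ∈ Finset.Icc 1 n, weight f s₀ z t ^ 2 =
      ∑ t ∈ Finset.Icc 1 n, f (partialSum s₀ z t / s₀) ^ 2 * (z t ^ 2 / s₀) := by
  refine Finset.sum_congr rfl fun t _ => ?_
  rw [weight, mul_pow, div_pow, Real.sq_sqrt hs₀.le]

lemma sum_weight_mul {f : ℝ → ℝ} (hs₀ : 0 < s₀) (n : ℕ) :
    ∑ t ∈ Finset.Icc 1 n, weight f s₀ z t * z t =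
      √s₀ * ∑ t ∈ Finset.Icc 1 n, f (partialSum s₀ z t / s₀) * (z t ^ 2 / s₀) := by
  rw [Finset.mul_sum]
  refine Finset.sum_congr rfl fun t _ => ?_
  have h : √s₀ ≠ 0 := (Real.sqrt_pos.2 hs₀).ne'
  have h2 : √s₀ ^ 2 = s₀ := Real.sq_sqrt hs₀.le
  rw [weight, ← h2, Real.sqrt_sq (Real.sqrt_nonneg _)]
  field_simp

end RiemannSum

/-! ### Properties of the weight function -/

section WeightFunction

variable {f : ℝ → ℝ}

lemma IsWeightFunction.antitoneOn_sq (hf : IsWeightFunction f) :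
    AntitoneOn (fun u => f u ^ 2) (Set.Ici 1) :=
  fun _ hx y hy hxy => pow_le_pow_left₀ (hf.pos y hy).le (hf.antitone hx hy hxy) 2

lemma IsWeightFunction.integrableOn_sq (hf : IsWeightFunction f) :
    IntegrableOn (fun u => f u ^ 2) (Set.Ioi 1) := by
  refine ⟨(aemeasurable_restrict_of_antitoneOn measurableSet_Ioi
    (hf.antitoneOn_sq.mono Set.Ioi_subset_Ici_self)).aestronglyMeasurable, ?_⟩
  rw [hasFiniteIntegral_iff_ofReal (ae_of_all _ fun _ => sq_nonneg _), hf.integral_sq]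
  exact ENNReal.one_lt_top

lemma IsWeightFunction.integral_Ioi_sq (hf : IsWeightFunction f) :
    ∫ u in Set.Ioi 1, f u ^ 2 = 1 := by
  rw [integral_eq_lintegral_of_nonneg_ae (ae_of_all _ fun _ => sq_nonneg _)
    hf.integrableOn_sq.aestronglyMeasurable, hf.integral_sq, ENNReal.toReal_one]

lemma IsWeightFunction.intervalIntegral_sq_le_one (hf : IsWeightFunction f) {R : ℝ} (hR : 1 ≤ R) :
    ∫ u in (1 : ℝ)..R, f u ^ 2 ≤ 1 := by
  rw [intervalIntegral.integral_of_le hR]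
  exact (setIntegral_mono_set hf.integrableOn_sq (ae_of_all _ fun _ => sq_nonneg _)
    Set.Ioc_subset_Ioi_self.eventuallyLE).trans_eq hf.integral_Ioi_sq

lemma IsWeightFunction.tendsto_intervalIntegral_sq (hf : IsWeightFunction f) :
    Tendsto (fun R => ∫ u in (1 : ℝ)..R, f u ^ 2) atTop (𝓝 1) := by
  have := intervalIntegral_tendsto_integral_Ioi 1 hf.integrableOn_sq tendsto_id
  rwa [hf.integral_Ioi_sq] at this

lemma IsWeightFunction.monotoneOn_intervalIntegral (hf : IsWeightFunction f) :
    MonotoneOn (fun R => ∫ u in (1 : ℝ)..R, f u) (Set.Ici 1) := by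
  intro a ha b hb hab
  simp only []
  rw [← intervalIntegral.integral_add_adjacent_intervals
    (intervalIntegrable_of_antitoneOn hf.antitone le_rfl ha)
    (intervalIntegrable_of_antitoneOn hf.antitone ha hb), le_add_iff_nonneg_right]
  exact intervalIntegral.integral_nonneg hab fun u hu => (hf.pos u (ha.trans hu.1)).le

/-- Otherwise all the integrals stay below `1` and `f` is integrable on `(1, ∞)`. Any positive
constant would serve in place of `1`. -/
lemma IsWeightFunction.exists_one_le_intervalIntegral (hf : IsWeightFunction f) :
    ∃ L : ℝ, 1 ≤ L ∧ ∀ R, L ≤ R → 1 ≤ ∫ u in (1 : ℝ)..R, f u := by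
  suffices h : ∃ L : ℝ, 1 ≤ L ∧ 1 ≤ ∫ u in (1 : ℝ)..L, f u by
    obtain ⟨L, hL, h1⟩ := h
    exact ⟨L, hL, fun R hR => h1.trans (hf.monotoneOn_intervalIntegral hL (hL.trans hR) hR)⟩
  by_contra! h
  have hi : IntegrableOn f (Set.Ioi 1) := by
    refine integrableOn_Ioi_of_intervalIntegral_norm_bounded (l := atTop) (b := fun x : ℝ => max 1 x)
      1 1 (fun x => ?_) (tendsto_atTop_mono (fun x => le_max_right 1 x) tendsto_id)
      (Eventually.of_forall fun x => ?_)
    · exact (intervalIntegrable_iff_integrableOn_Ioc_of_le (le_max_left _ _)).1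
        (intervalIntegrable_of_antitoneOn hf.antitone le_rfl (le_max_left _ _))
    · refine (le_of_eq ?_).trans (h (max 1 x) (le_max_left _ _)).le
      refine intervalIntegral.integral_congr fun u hu => ?_
      rw [Set.uIcc_of_le (le_max_left _ _)] at hu
      exact abs_of_pos (hf.pos u hu.1)
  have h1 := hi.lintegral_lt_top
  rw [hf.integral_eq_top] at h1
  exact lt_irrefl _ h1

/-- Nothing is known of `f` below `1`; clamping the argument gives a globally monotone, hence Borel,
function. -/
lemma IsWeightFunction.measurable_comp_max (hf : IsWeightFunction f) :
    Measurable fun u => f (max 1 u) := by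
  have : Antitone fun u => f (max 1 u) := fun x y hxy =>
    hf.antitone (le_max_left 1 x) (le_max_left 1 y) (max_le_max le_rfl hxy)
  exact this.measurable

lemma IsWeightFunction.measurable_intervalIntegral_max (hf : IsWeightFunction f) :
    Measurable fun R => ∫ u in (1 : ℝ)..max 1 R, f u := by
  have : Monotone fun R => ∫ u in (1 : ℝ)..max 1 R, f u := fun x y hxy =>
    hf.monotoneOn_intervalIntegral (le_max_left 1 x) (le_max_left 1 y) (max_le_max le_rfl hxy)
  exact this.measurable

end WeightFunction

/-! ### Convergence in probability to constants -/

section ConvergenceInMeasure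

variable {Ω : Type*} {mΩ : MeasurableSpace Ω} {P : Measure Ω} {X Y W : ℕ → Ω → ℝ} {c d e : ℝ}

/-- A union bound on the two exceptional events. It turns pointwise inequalities into convergence in
probability, without measurability of `W`. -/
lemma tendstoInMeasure_const_of_forall_abs_lt (hX : TendstoInMeasure P X atTop fun _ => c)
    (hY : TendstoInMeasure P Y atTop fun _ => d)
    (h : ∀ η > 0, ∃ γ > 0, ∀ n ω, |X n ω - c| < γ → |Y n ω - d| < γ → |W n ω - e| < η) :
    TendstoInMeasure P W atTop fun _ => e := by
  rw [tendstoInMeasure_iff_norm] at hX hY ⊢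
  intro η hη
  obtain ⟨γ, hγ, hW⟩ := h η hη
  have hsum := (hX γ hγ).add (hY γ hγ)
  rw [add_zero] at hsum
  refine tendsto_of_tendsto_of_tendsto_of_le_of_le tendsto_const_nhds hsum (fun _ => zero_le)
    fun n => (measure_mono fun ω hω => ?_).trans (measure_union_le _ _)
  by_contra hc
  simp only [Set.mem_union, Set.mem_ofPred_eq, not_or, not_le, Real.norm_eq_abs] at hc hω
  exact (hW n ω hc.1 hc.2).not_ge hω

lemma tendstoInMeasure_const_comp₂ (hX : TendstoInMeasure P X atTop fun _ => c)
    (hY : TendstoInMeasure P Y atTop fun _ => d) {φ : ℝ × ℝ → ℝ} (hφ : ContinuousAt φ (c, d)) :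
    TendstoInMeasure P (fun n ω => φ (X n ω, Y n ω)) atTop fun _ => φ (c, d) := by
  refine tendstoInMeasure_const_of_forall_abs_lt hX hY fun η hη => ?_
  obtain ⟨γ, hγ, h⟩ := Metric.continuousAt_iff.1 hφ η hη
  refine ⟨γ, hγ, fun n ω h1 h2 => h ?_⟩
  rw [Prod.dist_eq]
  exact max_lt h1 h2

end ConvergenceInMeasure

/-! ### Measurability and estimating equations for a bandit -/

variable {Ω : Type*} {mΩ : MeasurableSpace Ω}

namespace IsBandit

variable {K : ℕ} {F : Filtration ℕ mΩ} {θ : Fin K → ℝ} {x : ℕ → Ω → Fin K → ℝ} {y ε : ℕ → Ω → ℝ}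
  {n t : ℕ}

lemma sq_eq_zero_or_one (h : IsBandit F θ x y ε n) (ht : t ∈ Finset.Icc 1 n) (ω : Ω) (k : Fin K) :
    x t ω k ^ 2 = 0 ∨ x t ω k ^ 2 = 1 := by
  obtain ⟨j, hj⟩ := h.arm t ht ω
  rw [hj]
  rcases eq_or_ne k j with rfl | hkj
  · simp
  · simp [hkj]

lemma measurable_noise (h : IsBandit F θ x y ε n) (ht : t ∈ Finset.Icc 1 n) :
    Measurable[F t] (ε t) := by
  have hx : Measurable[F t] (x t) :=
    (h.arm_measurable t ht).mono (F.mono (Nat.sub_le t 1)) le_rfl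
  have hdot : Measurable fun v : Fin K → ℝ => v ⬝ᵥ θ := by
    unfold dotProduct
    fun_prop
  have he : ε t = fun ω => y t ω - x t ω ⬝ᵥ θ := by
    ext ω
    rw [h.reward t ht ω]
    ring
  rw [he]
  exact (h.reward_measurable t ht).sub (hdot.comp hx)

lemma measurable_partialSum (h : IsBandit F θ x y ε n) {s₀ : Ω → ℝ} (hs₀ : Measurable[F 0] s₀)
    (ht : t ≤ n) (k : Fin K) :
    Measurable[F (t - 1)] fun ω => partialSum (s₀ ω) (fun i => x i ω k) t := by
  unfold partialSum
  refine (hs₀.mono (F.mono (Nat.zero_le _)) le_rfl).add (Finset.measurable_fun_sum _ fun i hi => ?_)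
  obtain ⟨h1, h2⟩ := Finset.mem_Icc.1 hi
  have hx : Measurable[F (t - 1)] (x i) :=
    (h.arm_measurable i (Finset.mem_Icc.2 ⟨h1, h2.trans ht⟩)).mono (F.mono (by omega)) le_rfl
  exact ((measurable_pi_apply k).comp hx).pow_const 2

lemma measurable_weight (h : IsBandit F θ x y ε n) {f : ℝ → ℝ} (hf : IsWeightFunction f)
    {s₀ : Ω → ℝ} (hs₀ : Measurable[F 0] s₀) (hs₀_pos : ∀ ω, 0 < s₀ ω) (ht : t ∈ Finset.Icc 1 n)
    (k : Fin K) : Measurable[F (t - 1)] fun ω => weight f (s₀ ω) (fun i => x i ω k) t := by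
  have he : (fun ω => weight f (s₀ ω) (fun i => x i ω k) t) = fun ω =>
      f (max 1 (partialSum (s₀ ω) (fun i => x i ω k) t / s₀ ω)) * (x t ω k / √(s₀ ω)) := by
    ext ω
    rw [weight, max_eq_right (one_le_partialSum_div (hs₀_pos ω) t)]
  rw [he]
  have hs₀' : Measurable[F (t - 1)] s₀ := hs₀.mono (F.mono (Nat.zero_le _)) le_rfl
  have hr := h.measurable_partialSum hs₀ (Finset.mem_Icc.1 ht).2 k
  exact (hf.measurable_comp_max.comp (hr.div hs₀')).mul
    (((measurable_pi_apply k).comp (h.arm_measurable t ht)).div hs₀'.sqrt)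

lemma abs_weight_le (h : IsBandit F θ x y ε n) {f : ℝ → ℝ} (hf : IsWeightFunction f) {s₀ : ℝ}
    (hs₀ : 0 < s₀) (ht : t ∈ Finset.Icc 1 n) (k : Fin K) (ω : Ω) :
    |weight f s₀ (fun i => x i ω k) t| ≤ f 1 * √(1 / s₀) := by
  have hr := one_le_partialSum_div (z := fun i => x i ω k) hs₀ t
  have hx : |x t ω k| ≤ 1 := by
    rw [← sq_le_one_iff_abs_le_one]
    rcases h.sq_eq_zero_or_one ht ω k with h0 | h0 <;> linarith
  rw [weight, abs_mul, abs_of_pos (hf.pos _ hr), abs_div, abs_of_nonneg (Real.sqrt_nonneg _),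
    Real.sqrt_div zero_le_one, Real.sqrt_one]
  have := hf.antitone (Set.mem_Ici.2 le_rfl) (Set.mem_Ici.2 hr) hr
  have := (hf.pos 1 le_rfl).le
  gcongr

/-- For a bandit, the `k`-th estimating equation only involves the `k`-th parameter. -/
lemma sum_weight_mul_sub_eq (h : IsBandit F θ x y ε n) {f : ℝ → ℝ} {s₀ : Fin K → ℝ} {ω : Ω}
    {θhat : Fin K → ℝ}
    (hθ : IsALEE (fun t j => weight f (s₀ j) (fun i => x i ω j) t) (fun t => x t ω)
      (fun t => y t ω) n θhat) (k : Fin K) :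
    (∑ t ∈ Finset.Icc 1 n, weight f (s₀ k) (fun i => x i ω k) t * x t ω k) * (θhat k - θ k) =
      ∑ t ∈ Finset.Icc 1 n, weight f (s₀ k) (fun i => x i ω k) t * ε t ω := by
  have hk := congrFun hθ k
  simp only [Finset.sum_apply, Pi.smul_apply, smul_eq_mul, Pi.zero_apply] at hk
  rw [← sub_eq_zero, ← neg_eq_zero, ← hk, Finset.sum_mul, ← Finset.sum_sub_distrib,
    ← Finset.sum_neg_distrib]
  refine Finset.sum_congr rfl fun t ht => ?_
  obtain ⟨j, hj⟩ := h.arm t ht ω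
  rw [h.reward t ht ω, hj, weight, hj]
  simp only [single_dotProduct, one_mul]
  rcases eq_or_ne k j with rfl | hkj
  · simp only [Pi.single_eq_same]
    ring
  · simp [hkj]

end IsBandit

lemma NoiseCondition.tendstoInDistribution_sum {P : Measure Ω} [IsProbabilityMeasure P]
    {K : ℕ} {θ : Fin K → ℝ} {σ : ℝ} (hσ : 0 < σ)
    {F : ℕ → Filtration ℕ mΩ} {x : ℕ → ℕ → Ω → Fin K → ℝ} {y ε : ℕ → ℕ → Ω → ℝ}
    (hnoise : NoiseCondition P F ε σ) (hbandit : ∀ n, IsBandit (F n) θ (x n) (y n) (ε n) n)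
    {v : ℕ → ℕ → Ω → ℝ} {b : ℕ → Ω → ℝ}
    (hv : ∀ n, ∀ t ∈ Finset.Icc 1 n, Measurable[F n (t - 1)] (v n t))
    (hvb : ∀ n, ∀ t ∈ Finset.Icc 1 n, ∀ ω, |v n t ω| ≤ b n ω) (hbm : ∀ n, Measurable (b n))
    (hb : TendstoInMeasure P b atTop fun _ => 0)
    (hv1 : ∀ n ω, ∑ t ∈ Finset.Icc 1 n, v n t ω ^ 2 ≤ 1)
    (hV : TendstoInMeasure P (fun n ω => ∑ t ∈ Finset.Icc 1 n, v n t ω ^ 2) atTop fun _ => 1) :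
    TendstoInDistribution (fun n ω => ∑ t ∈ Finset.Icc 1 n, v n t ω * (ε n t ω / σ)) atTop id
      (fun _ => P) (gaussianReal 0 1) := by
  obtain ⟨δ, hδ, hmom⟩ := hnoise.moment
  set G : ℕ → ℕ → Ω → ℝ≥0∞ := fun n t =>
    P⁻[fun ω' => ENNReal.ofReal (|ε n t ω' / σ| ^ (2 + δ)) | F n (t - 1)] with hG
  have hGm : ∀ n t, Measurable (G n t) := fun n t => measurable_condLExp' _ _ _
  refine tendstoInDistribution_sum_mul (ℱ := F) (ξ := fun n t ω => ε n t ω / σ)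
    (C := fun ω => ⨆ n : ℕ, ⨆ t ∈ Finset.Icc 1 n, G n t ω) hδ
    (fun n t ht => ((hbandit n).measurable_noise ht).div_const σ) (fun n t ht => ?_)
    (fun n t ht => ?_) (fun n t ht => ae_of_all _ fun ω => ?_) ?_ hmom hv hvb hbm hb hv1 hV
  · have h := condExp_smul (μ := P) σ⁻¹ (ε n t) (F n (t - 1))
    have e : (fun ω => ε n t ω / σ) = σ⁻¹ • ε n t := by
      ext ω
      simp [div_eq_inv_mul]
    rw [e]
    filter_upwards [h, hnoise.mean n t ht] with ω h1 h2
    simp [h1, h2]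
  · have h := condExp_smul (μ := P) (σ ^ 2)⁻¹ (fun ω => ε n t ω ^ 2) (F n (t - 1))
    have e : (fun ω => (ε n t ω / σ) ^ 2) = (σ ^ 2)⁻¹ • fun ω => ε n t ω ^ 2 := by
      ext ω
      simp [div_eq_inv_mul, mul_pow]
    rw [e]
    filter_upwards [h, hnoise.variance n t ht] with ω h1 h2
    simp [h1, h2, hσ.ne']
  · exact le_iSup_of_le n (le_iSup₂_of_le (f := fun t _ => G n t ω) t ht le_rfl)
  · exact Measurable.iSup fun n => Measurable.iSup fun t => Measurable.iSup fun _ => hGm n t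

end Bandit

/-! ### Assembly of the main theorem -/

theorem theorem1 {Ω : Type*} {mΩ : MeasurableSpace Ω} (P : Measure Ω) [IsProbabilityMeasure P]
    {K : ℕ} (θ : Fin K → ℝ) (σ : ℝ) (hσ : 0 < σ)
    -- the experiments, one for each horizon `n`
    (F : ℕ → Filtration ℕ mΩ) (x : ℕ → ℕ → Ω → Fin K → ℝ) (y ε : ℕ → ℕ → Ω → ℝ)
    (hbandit : ∀ n, Bandit.IsBandit (F n) θ (x n) (y n) (ε n) n)
    (hnoise : Bandit.NoiseCondition P F ε σ)
    -- the weights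
    (f : ℝ → ℝ) (hf : Bandit.IsWeightFunction f)
    (s₀ : ℕ → Fin K → Ω → ℝ) (hs₀_pos : ∀ n j ω, 0 < s₀ n j ω)
    (hs₀_meas : ∀ n j, Measurable[F n 0] (s₀ n j))
    (s w : ℕ → ℕ → Fin K → Ω → ℝ)
    (hs : ∀ n t j ω, s n t j ω = Bandit.partialSum (s₀ n j ω) (fun i => x n i ω j) t)
    (hw : ∀ n t j ω, w n t j ω = Bandit.weight f (s₀ n j ω) (fun i => x n i ω j) t)
    -- the estimators
    (θhat : ℕ → Ω → Fin K → ℝ) (hθhat_meas : ∀ n, Measurable (θhat n))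
    (hθhat : ∀ n ω, Bandit.IsALEE (fun t j => w n t j ω) (fun t => x n t ω) (fun t => y n t ω) n
      (θhat n ω))
    (σhat : ℕ → Ω → ℝ) (hσhat_meas : ∀ n, Measurable (σhat n))
    (hσhat : TendstoInMeasure P σhat atTop (fun _ => σ))
    -- the arm
    (k : Fin K)
    (h₁ : TendstoInMeasure P (fun n ω => 1 / s₀ n k ω) atTop (fun _ => 0))
    (h₂ : TendstoInMeasure P (fun n ω => s₀ n k ω / s n n k ω) atTop (fun _ => 0)) :
    TendstoInDistribution
      (fun n ω => (θhat n ω k - θ k) *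
        ∫ u in (1 : ℝ)..(s n n k ω / s₀ n k ω), √(s₀ n k ω) / σhat n ω * f u)
      atTop id (fun _ => P) (gaussianReal 0 1) ∧
    TendstoInDistribution
      (fun n ω => 1 / (σhat n ω * √(∑ t ∈ Finset.Icc 1 n, w n t k ω ^ 2)) *
        (∑ t ∈ Finset.Icc 1 n, w n t k ω * x n t ω k) * (θhat n ω k - θ k))
      atTop id (fun _ => P) (gaussianReal 0 1) := by
  have hf1 : 0 < f 1 := hf.pos 1 le_rfl
  set r : ℕ → Ω → ℝ := fun n ω => s n n k ω / s₀ n k ω with hr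
  set V : ℕ → Ω → ℝ := fun n ω => ∑ t ∈ Finset.Icc 1 n, w n t k ω ^ 2 with hV
  set H : ℕ → Ω → ℝ := fun n ω => ∑ t ∈ Finset.Icc 1 n,
    f (Bandit.partialSum (s₀ n k ω) (fun i => x n i ω k) t / s₀ n k ω) *
      (x n t ω k ^ 2 / s₀ n k ω) with hH
  set I : ℕ → Ω → ℝ := fun n ω => ∫ u in (1 : ℝ)..r n ω, f u with hI
  set M : ℕ → Ω → ℝ := fun n ω => ∑ t ∈ Finset.Icc 1 n, w n t k ω * (ε n t ω / σ) with hM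
  have hr1 : ∀ n ω, 1 ≤ r n ω := fun n ω => by
    simp only [hr, hs]
    exact Bandit.one_le_partialSum_div (hs₀_pos n k ω) n
  have hs₀m : ∀ n, Measurable (s₀ n k) := fun n => (hs₀_meas n k).mono ((F n).le _) le_rfl
  have hwF : ∀ n, ∀ t ∈ Finset.Icc 1 n, Measurable[F n (t - 1)] (w n t k) := fun n t ht => by
    rw [show w n t k = _ from funext (hw n t k)]
    exact (hbandit n).measurable_weight hf (hs₀_meas n k) (hs₀_pos n k) ht k
  have hwm : ∀ n, ∀ t ∈ Finset.Icc 1 n, Measurable (w n t k) := fun n t ht =>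
    (hwF n t ht).mono ((F n).le _) le_rfl
  have hxm : ∀ n, ∀ t ∈ Finset.Icc 1 n, Measurable fun ω => x n t ω k := fun n t ht =>
    (measurable_pi_apply k).comp (((hbandit n).arm_measurable t ht).mono ((F n).le _) le_rfl)
  have hVm : ∀ n, Measurable (V n) := fun n =>
    Finset.measurable_fun_sum _ fun t ht => (hwm n t ht).pow_const 2
  have hrm : ∀ n, Measurable (r n) := fun n => by
    have : Measurable (s n n k) := by
      rw [show s n n k = _ from funext (hs n n k)]
      exact ((hbandit n).measurable_partialSum (hs₀_meas n k) le_rfl k).mono ((F n).le _) le_rfl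
    exact this.div (hs₀m n)
  have hIm : ∀ n, Measurable (I n) := fun n => by
    have : I n = fun ω => ∫ u in (1 : ℝ)..max 1 (r n ω), f u := by
      ext ω
      rw [max_eq_right (hr1 n ω)]
    rw [this]
    exact hf.measurable_intervalIntegral_max.comp (hrm n)
  have hz : ∀ n ω, ∀ t ∈ Finset.Icc 1 n, x n t ω k ^ 2 = 0 ∨ x n t ω k ^ 2 = 1 :=
    fun n ω t ht => (hbandit n).sq_eq_zero_or_one ht ω k
  have hVI : ∀ n ω, V n ω ≤ ∫ u in (1 : ℝ)..r n ω, f u ^ 2 ∧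
      ∫ u in (1 : ℝ)..r n ω, f u ^ 2 ≤ V n ω + f 1 ^ 2 * (1 / s₀ n k ω) := fun n ω => by
    have h := Bandit.riemannSum_le_integral_le hf.antitoneOn_sq (hs₀_pos n k ω) (hz n ω)
    rw [← Bandit.sum_weight_sq (hs₀_pos n k ω)] at h
    simp only [← hw, ← hs] at h
    refine ⟨h.1, h.2.trans (add_le_add le_rfl ?_)⟩
    rw [mul_one_div]
    have := hs₀_pos n k ω
    gcongr
    linarith [sq_nonneg (f (s n n k ω / s₀ n k ω))]
  have hHI : ∀ n ω, H n ω ≤ I n ω ∧ I n ω ≤ H n ω + f 1 * (1 / s₀ n k ω) := fun n ω => by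
    have h := Bandit.riemannSum_le_integral_le hf.antitone (hs₀_pos n k ω) (hz n ω)
    refine ⟨by simpa only [hI, hH, hr, hs] using h.1, ?_⟩
    simp only [hI, hH, hr, hs]
    refine h.2.trans (add_le_add le_rfl ?_)
    rw [mul_one_div]
    have := hs₀_pos n k ω
    gcongr
    linarith [hf.pos _ (Bandit.one_le_partialSum_div (z := fun i => x n i ω k) this n)]
  have hwx : ∀ n ω, ∑ t ∈ Finset.Icc 1 n, w n t k ω * x n t ω k = √(s₀ n k ω) * H n ω :=
    fun n ω => by
      simp only [hw]
      exact Bandit.sum_weight_mul (z := fun i => x n i ω k) (hs₀_pos n k ω) n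
  have hHm : ∀ n, Measurable (H n) := fun n => by
    have : H n = fun ω => (∑ t ∈ Finset.Icc 1 n, w n t k ω * x n t ω k) / √(s₀ n k ω) := by
      ext ω
      rw [hwx, mul_div_cancel_left₀ _ (Real.sqrt_pos.2 (hs₀_pos n k ω)).ne']
    rw [this]
    exact (Finset.measurable_fun_sum _ fun t ht => (hwm n t ht).mul (hxm n t ht)).div (hs₀m n).sqrt
  have hkey : ∀ n ω, √(s₀ n k ω) * H n ω * (θhat n ω k - θ k) = M n ω * σ := fun n ω => by
    have h := hθhat n ω
    simp only [hw] at h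
    rw [← hwx]
    simp only [hM, hw]
    rw [(hbandit n).sum_weight_mul_sub_eq h k, Finset.sum_mul]
    refine Finset.sum_congr rfl fun t _ => ?_
    rw [mul_assoc, div_mul_cancel₀ _ hσ.ne']
  have hlarge : ∀ L : ℝ, 1 ≤ L → ∀ n ω, |s₀ n k ω / s n n k ω - 0| < 1 / L → L ≤ r n ω := by
    intro L hL n ω h
    have hrp : 0 < r n ω := zero_lt_one.trans_le (hr1 n ω)
    have e : s₀ n k ω / s n n k ω = 1 / r n ω := by rw [hr, one_div_div]
    rw [sub_zero, e, abs_of_pos (by positivity)] at h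
    exact ((one_div_lt_one_div hrp (by linarith)).1 h).le
  have hVlim : TendstoInMeasure P V atTop fun _ => 1 := by
    refine Bandit.tendstoInMeasure_const_of_forall_abs_lt h₁ h₂ fun η hη => ?_
    obtain ⟨L, hL⟩ := eventually_atTop.1
      (hf.tendsto_intervalIntegral_sq.eventually (lt_mem_nhds (by linarith : 1 - η / 2 < 1)))
    -- The first bound brings `∫ f²` within `η / 2` of `1`, the second makes the Riemann error
    -- `f(1)² / s₀` less than `η / 2`.
    refine ⟨min (1 / max 1 L) (η / (2 * f 1 ^ 2)), by positivity, fun n ω h1 h2 => ?_⟩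
    have hR := hL _ ((le_max_right 1 L).trans
      (hlarge _ (le_max_left 1 L) n ω (h2.trans_le (min_le_left _ _))))
    have h3 := h1.trans_le (min_le_right _ _)
    rw [sub_zero, lt_div_iff₀ (by positivity)] at h3
    have h4 := le_abs_self (1 / s₀ n k ω)
    have h5 : f 1 ^ 2 * (1 / s₀ n k ω) ≤ |1 / s₀ n k ω| * (2 * f 1 ^ 2) / 2 := by
      nlinarith [sq_nonneg (f 1)]
    have h6 := (hVI n ω).1.trans (hf.intervalIntegral_sq_le_one (hr1 n ω))
    rw [abs_lt]
    constructor <;> linarith [(hVI n ω).2]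
  have hCLT : TendstoInDistribution M atTop id (fun _ => P) (gaussianReal 0 1) := by
    refine hnoise.tendstoInDistribution_sum hσ hbandit (b := fun n ω => f 1 * √(1 / s₀ n k ω)) hwF
      (fun n t ht ω => ?_) (fun n => ?_) ?_ (fun n ω => ?_) hVlim
    · rw [hw]
      exact (hbandit n).abs_weight_le hf (hs₀_pos n k ω) ht k ω
    · have := hs₀m n
      fun_prop
    · simpa using Bandit.tendstoInMeasure_const_comp₂ h₁ h₁
        (φ := fun p => f 1 * √p.1) (by fun_prop)
    · exact (hVI n ω).1.trans (hf.intervalIntegral_sq_le_one (hr1 n ω))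
  obtain ⟨L, hL1, hL⟩ := hf.exists_one_le_intervalIntegral
  -- Here `I ≥ 1`, and the Riemann error `f(1) / s₀` is below `1 / 2`.
  have hIH : ∀ n ω, |1 / s₀ n k ω - 0| < 1 / (2 * f 1) → |s₀ n k ω / s n n k ω - 0| < 1 / L →
      1 / 2 < H n ω := by
    intro n ω h1 h2
    have h3 := hL _ (hlarge L hL1 n ω h2)
    rw [sub_zero, lt_div_iff₀ (by positivity)] at h1
    have h4 := le_abs_self (1 / s₀ n k ω)
    have h5 := (hHI n ω).2
    simp only [hI] at h5
    nlinarith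
  have hQ : TendstoInMeasure P (fun n ω => I n ω / H n ω) atTop fun _ => 1 := by
    refine Bandit.tendstoInMeasure_const_of_forall_abs_lt h₁ h₂ fun η hη => ?_
    refine ⟨min (min (1 / (2 * f 1)) (1 / L)) (η / (2 * f 1)), ?_, fun n ω h1 h2 => ?_⟩
    · have : 0 < L := by linarith
      positivity
    have hH2 := hIH n ω (h1.trans_le ((min_le_left _ _).trans (min_le_left _ _)))
      (h2.trans_le ((min_le_left _ _).trans (min_le_right _ _)))
    have hH0 : 0 < H n ω := by linarith
    have h3 := h1.trans_le (min_le_right _ _)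
    rw [sub_zero, lt_div_iff₀ (by positivity)] at h3
    have h4 := le_abs_self (1 / s₀ n k ω)
    have h5 := hHI n ω
    rw [div_sub_one hH0.ne', abs_of_nonneg (div_nonneg (by linarith) hH0.le), div_lt_iff₀ hH0]
    nlinarith
  have slutsky : ∀ A : ℕ → Ω → ℝ, (∀ n, Measurable (A n)) →
      TendstoInMeasure P A atTop (fun _ => 1) →
      TendstoInDistribution (fun n ω => M n ω * A n ω) atTop id (fun _ => P)
        (gaussianReal 0 1) := by
    intro A hAm hA
    have := hCLT.continuous_comp_prodMk_of_tendstoInMeasure_const (g := fun p : ℝ × ℝ => p.1 * p.2)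
      (by fun_prop) hA fun n => (hAm n).aemeasurable
    exact this.congr (fun _ => .rfl) (ae_of_all _ fun _ => mul_one _)
  constructor
  · have hA : TendstoInMeasure P (fun n ω => σ / σhat n ω * (I n ω / H n ω)) atTop fun _ => 1 := by
      have := Bandit.tendstoInMeasure_const_comp₂ hσhat hQ (φ := fun p => σ / p.1 * p.2)
        (by fun_prop (disch := exact hσ.ne'))
      simpa [hσ.ne'] using this
    have hmain := slutsky _ (fun n => by
      have := hIm n
      have := hHm n
      have := hσhat_meas n
      fun_prop) hA
    have hTm : ∀ n, Measurable fun ω => (θhat n ω k - θ k) *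
        ∫ u in (1 : ℝ)..r n ω, √(s₀ n k ω) / σhat n ω * f u := fun n => by
      have h1 := hIm n
      have h2 := hs₀m n
      have h3 := hσhat_meas n
      have h4 : Measurable fun ω => θhat n ω k := (measurable_pi_apply k).comp (hθhat_meas n)
      simp only [intervalIntegral.integral_const_mul]
      exact (h4.sub_const _).mul ((h2.sqrt.div h3).mul h1)
    -- The statistic equals `M` times its Slutsky factor wherever `H ≠ 0`, which holds with
    -- probability tending to `1`.
    refine tendstoInDistribution_of_tendstoInMeasure_sub _ _ hmain ?_ fun n => (hTm n).aemeasurable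
    refine Bandit.tendstoInMeasure_const_of_forall_abs_lt h₁ h₂ fun η hη => ?_
    refine ⟨min (1 / (2 * f 1)) (1 / L), ?_, fun n ω h1 h2 => ?_⟩
    · have : 0 < L := by linarith
      positivity
    have hH0 : H n ω ≠ 0 := by
      linarith [hIH n ω (h1.trans_le (min_le_left _ _)) (h2.trans_le (min_le_right _ _))]
    have e : (θhat n ω k - θ k) * ∫ u in (1 : ℝ)..r n ω, √(s₀ n k ω) / σhat n ω * f u =
        M n ω * (σ / σhat n ω * (I n ω / H n ω)) := by
      rw [intervalIntegral.integral_const_mul]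
      calc _ = √(s₀ n k ω) * H n ω * (θhat n ω k - θ k) / σhat n ω * (I n ω / H n ω) := by
            field_simp
            simp only [hI]
        _ = _ := by
            rw [hkey]
            ring
    exact lt_of_eq_of_lt ((congrArg abs ((sub_zero _).trans (sub_eq_zero.2 e))).trans abs_zero) hη
  · have hA : TendstoInMeasure P (fun n ω => σ / (σhat n ω * √(V n ω))) atTop fun _ => 1 := by
      have := Bandit.tendstoInMeasure_const_comp₂ hσhat hVlim (φ := fun p => σ / (p.1 * √p.2))
        (by fun_prop (disch := simpa using hσ.ne'))
      simpa [hσ.ne'] using this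
    have hmain := slutsky _ (fun n => by
      have := hVm n
      have := hσhat_meas n
      fun_prop) hA
    -- This identity holds for every outcome: where `σhat` or `V` vanishes, both sides are `0` by
    -- the convention for division.
    convert hmain using 3 with n ω
    rw [hwx, mul_assoc, hkey]
    ring
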